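/- Let $M$ be a monoid given by a monoid presentation $\langle X\mid R\rangle$ via $\phi:X^*\to M$; that is, $\phi$ is a surjective monoid morphism whose kernel is the congruence on $X^*$ generated by $R\subseteq X^*\times X^*$. Let $M_0=M\cup\{0\}$ be $M$ with a new zero adjoined, let $n\ge 2$, and write $[n]=\{1,\dots,n\}$. Let $\mathcal I_n$ be the symmetric inverse monoid of all partial bijections of $[n]$ (maps act on the right and are composed left to right), $\mathcal S_n$ the symmetric group, and $\mathrm{Sing}(\mathcal I_n)=\mathcal I_n\setminus\mathcal S_n$. For $\mathbf a\in M_0^n$ let $\mathrm{supp}(\mathbf a)=\{i: a_i\ne0\}$, and for $\alpha\in\mathcal I_n$ let ${}^\alpha\mathbf a$ be the tuple whose $i$th entry is $a_{i\alpha}$ if $i\in\mathrm{dom}(\alpha)$, and $0$ otherwise. The singular wreath product is the semigroup $$M\wr\mathrm{Sing}(\mathcal I_n)=\{(\mathbf a,\alpha)\in M_0^n\times\mathrm{Sing}(\mathcal I_n): \mathrm{supp}(\mathbf a)=\mathrm{dom}(\alpha)\},\qquad (\mathbf a,\alpha)(\mathbf b,\beta)=(\mathbf a\cdot{}^\alpha\mathbf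 b,\ \alpha\beta).$$ Identify $\alpha\in\mathrm{Sing}(\mathcal I_n)$ with $(\mathbf 1_{\mathrm{dom}(\alpha)},\alpha)$, where $\mathbf 1_A$ is the $\{0,1\}$-tuple with support $A$, and identify $\mathbf a\in M_0^n\setminus M^n$ with $(\mathbf a,\mathrm{id}_{\mathrm{supp}(\mathbf a)})$. Consider the alphabet $$Y=\{f_{i,j}: i,j\in[n],\ i\ne j\}\cup\{e_i: i\in[n]\}\cup\{x^{(i;j)}: x\in X,\ i,j\in[n],\ i\ne j\},$$ and let $\Phi:Y^+\to M\wr\mathrm{Sing}(\mathcal I_n)$ be the semigroup morphism that sends - $f_{i,j}$ to the partial bijection that maps $j\mapsto i$, is undefined at $i$, and fixes all $k\ne i,j$; - $e_i$ to the tuple with $0$ in position $i$ and $1$ elsewhere; - $x^{(i;j)}$ to the tuple with $\phi(x)$ in position $i$, $0$ in position $j$, and $1$ elsewhere. For $w=x_1\cdots x_k\in X^*$ and $i\ne j$, put $w^{(i;j)}=x_1^{(i;j)}\cdots x_k^{(i;j)}$ if $k\ge1$, and $w^{(i;j)}=e_j$ if $k=0$. Then $M\wr\mathrm{Sing}(\mathcal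 I_n)$ has semigroup presentation $\langle Y\mid Q\rangle$ via $\Phi$; that is, $\Phi$ is surjective and its kernel is the congruence on $Y^+$ generated by $Q$, where $Q$ consists of the following relations, for all $x,y\in X$ and all $i,j,k,l\in[n]$ for which all the letters displayed are defined, subject to the stated constraints. (S) East's relations for $\mathrm{Sing}(\mathcal I_n)$, with the indices occurring in each relation distinct: $f_{i,j}f_{j,i}f_{i,j}=f_{i,j}$; $\ f_{i,j}^3=f_{i,j}^2=f_{j,i}^2$; $\ f_{i,j}f_{k,l}=f_{k,l}f_{i,j}$; $\ f_{i,j}f_{j,i}=f_{i,k}f_{k,i}$; $\ f_{i,j}f_{i,k}=f_{j,k}f_{i,j}=f_{i,k}f_{j,k}$; $\ f_{k,i}f_{i,j}f_{j,k}=f_{k,j}f_{j,i}f_{i,k}$; $\ f_{k,i}f_{i,j}f_{j,k}f_{k,l}=f_{k,l}f_{l,i}f_{i,j}f_{j,l}$. (M) The relations for $M_0^n\setminus M^n$: $e_i^2=e_i$; $\ e_ie_j=e_je_i$; $\ u^{(i;j)}=v^{(i;j)}$ for $(u,v)\in R$; $\ x^{(i;j)}e_k=e_kx^{(i;j)}=e_jx^{(i;k)}$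 if $k\ne i,j$; $\ x^{(i;j)}e_j=e_jx^{(i;j)}=x^{(i;j)}$; $\ x^{(i;j)}e_i=e_ix^{(i;j)}=e_ie_j$; $\ x^{(i;k)}y^{(j;k)}=y^{(j;k)}x^{(i;k)}$ if $i\ne j$. (MS) The mixed relations: $f_{i,j}f_{j,i}=e_i$; $\ f_{i,j}x^{(i;j)}=x^{(j;i)}f_{i,j}$; $\ f_{i,j}x^{(i;k)}=x^{(j;k)}f_{i,j}$; $\ f_{i,j}x^{(k;i)}=x^{(k;i)}e_j$ (including $k=j$); $\ f_{i,j}x^{(j;k)}=f_{i,j}f_{k,j}$ (including $k=i$); $\ f_{i,j}x^{(k;j)}=x^{(k;i)}f_{i,j}$; $\ f_{i,j}x^{(k;l)}=x^{(k;l)}f_{i,j}$ if $\{i,j\}\cap\{k,l\}=\varnothing$. -/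

import Mathlib

namespace SingWreath

/-- The monoid `M` has presentation `⟨X | R⟩` via `φ`: `φ` is a surjective morphism from the free
monoid over `X`, and its kernel is the congruence generated by `R`. -/
def IsMonoidPresentation {X M : Type*} [Monoid M] (R : FreeMonoid X → FreeMonoid X → Prop)
    (φ : FreeMonoid X →* M) : Prop :=
  Function.Surjective φ ∧ Con.ker φ = conGen R

/-- The semigroup `S` has presentation `⟨X | R⟩` via `φ`: `φ` is a surjective morphism from the
free semigroup over `X`, and its kernel is the congruence generated by `R`. -/
def IsSemigroupPresentation {X S : Type*} [Semigroup S]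
    (R : FreeSemigroup X → FreeSemigroup X → Prop) (φ : FreeSemigroup X →ₙ* S) : Prop :=
  Function.Surjective φ ∧ Con.ker φ = conGen R

/-! ### The symmetric inverse monoid and its singular part -/

/-- The symmetric inverse monoid: all partial bijections of an `n`-element set. -/
abbrev SymInv (n : ℕ) : Type := Fin n ≃. Fin n

/-- Partial maps are composed from left to right: `i (α * β) = (i α) β`. -/
instance (n : ℕ) : Monoid (SymInv n) where
  mul α β := α.trans β
  one := PEquiv.refl (Fin n)
  mul_assoc := PEquiv.trans_assoc
  one_mul := PEquiv.refl_trans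
  mul_one := PEquiv.trans_refl

theorem SymInv.mul_def {n : ℕ} (α β : SymInv n) : α * β = α.trans β := rfl

/-- The domain of a partial map. -/
def dom {n : ℕ} (α : SymInv n) : Set (Fin n) := {i | (α i).isSome}

theorem SymInv.exists_perm_of_dom {n : ℕ} (α : SymInv n) (h : dom α = Set.univ) :
    ∃ σ : Equiv.Perm (Fin n), σ.toPEquiv = α := by
  have h' : ∀ i, (α i).isSome := fun i => by
    have : i ∈ dom α := by rw [h]; trivial
    exact this
  have hinj : Function.Injective (fun i => (α i).get (h' i)) := by
    intro i j hij
    exact α.inj (Option.get_mem (h' i)) (by simp only [hij]; exact Option.get_mem (h' j))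
  refine ⟨Equiv.ofBijective _ (Finite.injective_iff_bijective.mp hinj), ?_⟩
  ext i : 1
  simp [Equiv.toPEquiv_apply]

theorem SymInv.dom_toPEquiv {n : ℕ} (σ : Equiv.Perm (Fin n)) :
    dom (σ.toPEquiv : SymInv n) = Set.univ := by
  ext i
  simp [dom, Equiv.toPEquiv_apply]

/-- The singular part of the symmetric inverse monoid: the partial bijections that are not
permutations. -/
def singSymInv (n : ℕ) : Subsemigroup (SymInv n) where
  carrier := {α | ¬ ∃ σ : Equiv.Perm (Fin n), σ.toPEquiv = α}
  mul_mem' := by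
    rintro α β hα - ⟨σ, hσ⟩
    refine hα (α.exists_perm_of_dom (Set.eq_univ_of_forall fun i => ?_))
    have hi : i ∈ dom (α * β) := by rw [← hσ, SymInv.dom_toPEquiv]; trivial
    simp only [dom, Set.mem_ofPred_eq, SymInv.mul_def, Option.isSome_iff_exists] at hi ⊢
    obtain ⟨c, hc⟩ := hi
    obtain ⟨b, hb, -⟩ := (PEquiv.trans_eq_some α β i c).mp hc
    exact ⟨b, hb⟩

theorem mem_singSymInv_of_notMem_dom {n : ℕ} {α : SymInv n} {i : Fin n} (h : i ∉ dom α) :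
    α ∈ singSymInv n := by
  rintro ⟨σ, rfl⟩
  rw [SymInv.dom_toPEquiv] at h
  exact h trivial

/-! ### Wreath products -/

/-- The support of a tuple over `M₀`, where `M₀` is `M` with a new zero adjoined. -/
def supp {M : Type*} {n : ℕ} (a : Fin n → WithZero M) : Set (Fin n) := {i | a i ≠ 0}

/-- The left action of partial bijections on tuples: the `i`-th entry of `ᵅa` is `a_{iα}` if `i` is
in the domain of `α`, and is `0` otherwise. -/
def act {M : Type*} {n : ℕ} (α : SymInv n) (a : Fin n → WithZero M) : Fin n → WithZero M :=
  fun i => (α i).elim 0 a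

/-- The wreath product of `M` with the symmetric inverse monoid: pairs `(a, α)` where `a` is an
`n`-tuple over `M₀`, `α` is a partial bijection, and the support of `a` is the domain of `α`. -/
@[ext]
structure Wreath (M : Type*) (n : ℕ) where
  tuple : Fin n → WithZero M
  map : SymInv n
  supp_tuple : supp tuple = dom map

/-- `(a, α) (b, β) = (a · ᵅb, αβ)`. -/
instance {M : Type*} [Monoid M] {n : ℕ} : Mul (Wreath M n) where
  mul x y :=
    { tuple := x.tuple * act x.map y.tuple
      map := x.map * y.map
      supp_tuple := by
        ext i
        have hx : i ∈ supp x.tuple ↔ i ∈ dom x.map := by rw [x.supp_tuple]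
        have hy : ∀ j, j ∈ supp y.tuple ↔ j ∈ dom y.map := fun j => by rw [y.supp_tuple]
        simp only [supp, dom, Set.mem_ofPred_eq] at hx hy
        simp only [supp, dom, act, Set.mem_ofPred_eq, SymInv.mul_def, Pi.mul_apply, PEquiv.trans,
          PEquiv.coe_mk, ne_eq, mul_eq_zero, not_or]
        cases h : x.map i with
        | none => simp
        | some j => simpa [h, hy j] using fun _ => hx.mpr (by simp [h]) }

theorem Wreath.tuple_mul {M : Type*} [Monoid M] {n : ℕ} (x y : Wreath M n) :
    (x * y).tuple = x.tuple * act x.map y.tuple := rfl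

theorem Wreath.map_mul {M : Type*} [Monoid M] {n : ℕ} (x y : Wreath M n) :
    (x * y).map = x.map * y.map := rfl

instance {M : Type*} [Monoid M] {n : ℕ} : Semigroup (Wreath M n) where
  mul_assoc x y z := by
    ext1
    · funext i
      simp only [Wreath.tuple_mul, Wreath.map_mul, act, SymInv.mul_def, Pi.mul_apply, PEquiv.trans,
        PEquiv.coe_mk]
      cases h : x.map i with
      | none => simp
      | some j => simp [mul_assoc, act]
    · simp only [Wreath.map_mul, mul_assoc]

/-- For a subsemigroup `S` of the symmetric inverse monoid, the wreath product of `M` with `S`: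
the pairs `(a, α)` in which `α` belongs to `S`. -/
def wreathOver (M : Type*) [Monoid M] {n : ℕ} (S : Subsemigroup (SymInv n)) :
    Subsemigroup (Wreath M n) where
  carrier := {x | x.map ∈ S}
  mul_mem' hx hy := S.mul_mem hx hy

open Classical in
/-- The identification of a tuple `a` with the pair `(a, id)`, where `id` is the identity map
on the support of `a`. -/
noncomputable def ofTuple {M : Type*} {n : ℕ} (a : Fin n → WithZero M) : Wreath M n where
  tuple := a
  map := PEquiv.ofSet (supp a)
  supp_tuple := by
    ext i
    simp [dom, Option.isSome_iff_exists, PEquiv.ofSet_eq_some_iff]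

/-- The identification of a partial bijection `α` with the pair `(1, α)`, where `1` is the tuple
over `{0, 1}` whose support is the domain of `α`. -/
def ofMap {M : Type*} [Monoid M] {n : ℕ} (α : SymInv n) : Wreath M n where
  tuple := act α 1
  map := α
  supp_tuple := by
    ext i
    simp only [supp, dom, act, Set.mem_ofPred_eq]
    cases α i <;> simp

/-! ### The generators -/

/-- The partial bijection that maps `j` to `i`, is undefined at `i`, and fixes every other point. -/
def fBar {n : ℕ} (i j : Fin n) : SymInv n where
  toFun k := if k = i then none else if k = j then some i else some k
  invFun k := if k = j then none else if k = i then some j else some k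
  inv := by grind

/-- The tuple with entry `0` in position `i`, and `1` elsewhere. -/
def eBar (M : Type*) [Monoid M] {n : ℕ} (i : Fin n) : Fin n → WithZero M :=
  fun k => if k = i then 0 else 1

/-- The tuple `a^{(i;j)}`, with entry `a` in position `i`, `0` in position `j`, and `1` elsewhere
(used for `i ≠ j`). -/
def xBar {M : Type*} [Monoid M] {n : ℕ} (a : M) (i j : Fin n) : Fin n → WithZero M :=
  fun k => if k = i then (a : WithZero M) else if k = j then 0 else 1

/-- The alphabet: letters `f_{i,j}` (`i ≠ j`), `e_i`, and `x^{(i;j)}` (`x ∈ X`, `i ≠ j`). -/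
inductive Gen (X : Type*) (n : ℕ) where
  | f (i j : Fin n) (h : i ≠ j) : Gen X n
  | e (i : Fin n) : Gen X n
  | x (x : X) (i j : Fin n) (h : i ≠ j) : Gen X n

theorem ofMap_fBar_mem {M : Type*} [Monoid M] {n : ℕ} (i j : Fin n) :
    ofMap (fBar i j) ∈ wreathOver M (singSymInv n) :=
  mem_singSymInv_of_notMem_dom (i := i) (by simp [ofMap, dom, fBar])

theorem ofTuple_mem {M : Type*} [Monoid M] {n : ℕ} {a : Fin n → WithZero M} {i : Fin n}
    (h : a i = 0) : ofTuple a ∈ wreathOver M (singSymInv n) :=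
  mem_singSymInv_of_notMem_dom (i := i) (by rw [← (ofTuple a).supp_tuple]; simp [supp, ofTuple, h])

/-- The images of the letters in the singular wreath product. -/
noncomputable def genImage {X M : Type*} [Monoid M] (φ : FreeMonoid X →* M) (n : ℕ) :
    Gen X n → wreathOver M (singSymInv n)
  | .f i j _ => ⟨ofMap (fBar i j), ofMap_fBar_mem i j⟩
  | .e i => ⟨ofTuple (eBar M i), ofTuple_mem (i := i) (by simp [eBar])⟩
  | .x x i j h => ⟨ofTuple (xBar (φ (FreeMonoid.of x)) i j),
      ofTuple_mem (i := j) (by simp [xBar, h.symm])⟩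

/-- The morphism from the free semigroup over the alphabet to the singular wreath product. -/
noncomputable def phiMS {X M : Type*} [Monoid M] (φ : FreeMonoid X →* M) (n : ℕ) :
    FreeSemigroup (Gen X n) →ₙ* wreathOver M (singSymInv n) :=
  FreeSemigroup.lift (genImage φ n)

/-! ### The relations -/

section Words

variable {X : Type*} {n : ℕ}

/-- The one-letter word `f_{i,j}`. -/
def f (i j : Fin n) (h : i ≠ j) : FreeSemigroup (Gen X n) := .of (.f i j h)

/-- The one-letter word `e_i`. -/
def e (i : Fin n) : FreeSemigroup (Gen X n) := .of (.e i)

/-- The one-letter word `x^{(i;j)}`. -/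
def x (a : X) (i j : Fin n) (h : i ≠ j) : FreeSemigroup (Gen X n) := .of (.x a i j h)

/-- The word `w^{(i;j)}`: this is `x₁^{(i;j)} ⋯ xₖ^{(i;j)}` if `w = x₁ ⋯ xₖ` is not empty, and `e_j`
if `w` is empty. -/
def word (w : FreeMonoid X) (i j : Fin n) (h : i ≠ j) : FreeSemigroup (Gen X n) :=
  match w.toList with
  | [] => e j
  | a :: l => ⟨.x a i j h, l.map fun b => .x b i j h⟩

end Words

/-- The relations for the singular part of the symmetric inverse monoid. -/
inductive RelS (X : Type*) (n : ℕ) : FreeSemigroup (Gen X n) → FreeSemigroup (Gen X n) → Prop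
  | s1 (i j : Fin n) (hij : i ≠ j) :
      RelS X n (f i j hij * f j i hij.symm * f i j hij) (f i j hij)
  | s2a (i j : Fin n) (hij : i ≠ j) :
      RelS X n (f i j hij * f i j hij * f i j hij) (f i j hij * f i j hij)
  | s2b (i j : Fin n) (hij : i ≠ j) :
      RelS X n (f i j hij * f i j hij) (f j i hij.symm * f j i hij.symm)
  | s3 (i j k l : Fin n) (hij : i ≠ j) (hik : i ≠ k) (hil : i ≠ l) (hjk : j ≠ k) (hjl : j ≠ l)
      (hkl : k ≠ l) :
      RelS X n (f i j hij * f k l hkl) (f k l hkl * f i j hij)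
  | s4 (i j k : Fin n) (hij : i ≠ j) (hik : i ≠ k) (hjk : j ≠ k) :
      RelS X n (f i j hij * f j i hij.symm) (f i k hik * f k i hik.symm)
  | s5a (i j k : Fin n) (hij : i ≠ j) (hik : i ≠ k) (hjk : j ≠ k) :
      RelS X n (f i j hij * f i k hik) (f j k hjk * f i j hij)
  | s5b (i j k : Fin n) (hij : i ≠ j) (hik : i ≠ k) (hjk : j ≠ k) :
      RelS X n (f j k hjk * f i j hij) (f i k hik * f j k hjk)
  | s6 (i j k : Fin n) (hij : i ≠ j) (hik : i ≠ k) (hjk : j ≠ k) :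
      RelS X n (f k i hik.symm * f i j hij * f j k hjk) (f k j hjk.symm * f j i hij.symm * f i k hik)
  | s7 (i j k l : Fin n) (hij : i ≠ j) (hik : i ≠ k) (hil : i ≠ l) (hjk : j ≠ k) (hjl : j ≠ l)
      (hkl : k ≠ l) :
      RelS X n (f k i hik.symm * f i j hij * f j k hjk * f k l hkl)
        (f k l hkl * f l i hil.symm * f i j hij * f j l hjl)

/-- The relations for the semigroup of all `n`-tuples over `M₀` with at least one zero entry, where
`R` is the set of relations in the given presentation of `M`. -/
inductive RelM {X : Type*} (R : FreeMonoid X → FreeMonoid X → Prop) (n : ℕ) :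
    FreeSemigroup (Gen X n) → FreeSemigroup (Gen X n) → Prop
  | m1 (i : Fin n) : RelM R n (e i * e i) (e i)
  | m2 (i j : Fin n) : RelM R n (e i * e j) (e j * e i)
  | m3 (u v : FreeMonoid X) (huv : R u v) (i j : Fin n) (hij : i ≠ j) :
      RelM R n (word u i j hij) (word v i j hij)
  | m4a (a : X) (i j k : Fin n) (hij : i ≠ j) (hki : k ≠ i) (hkj : k ≠ j) :
      RelM R n (x a i j hij * e k) (e k * x a i j hij)
  | m4b (a : X) (i j k : Fin n) (hij : i ≠ j) (hki : k ≠ i) (hkj : k ≠ j) :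
      RelM R n (e k * x a i j hij) (e j * x a i k hki.symm)
  | m5a (a : X) (i j : Fin n) (hij : i ≠ j) :
      RelM R n (x a i j hij * e j) (e j * x a i j hij)
  | m5b (a : X) (i j : Fin n) (hij : i ≠ j) :
      RelM R n (e j * x a i j hij) (x a i j hij)
  | m6a (a : X) (i j : Fin n) (hij : i ≠ j) :
      RelM R n (x a i j hij * e i) (e i * x a i j hij)
  | m6b (a : X) (i j : Fin n) (hij : i ≠ j) :
      RelM R n (e i * x a i j hij) (e i * e j)
  | m7 (a b : X) (i j k : Fin n) (hij : i ≠ j) (hik : i ≠ k) (hjk : j ≠ k) :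
      RelM R n (x a i k hik * x b j k hjk) (x b j k hjk * x a i k hik)

/-- The mixed relations. -/
inductive RelMixed (X : Type*) (n : ℕ) :
    FreeSemigroup (Gen X n) → FreeSemigroup (Gen X n) → Prop
  | ms1 (i j : Fin n) (hij : i ≠ j) : RelMixed X n (f i j hij * f j i hij.symm) (e i)
  | ms2 (a : X) (i j : Fin n) (hij : i ≠ j) :
      RelMixed X n (f i j hij * x a i j hij) (x a j i hij.symm * f i j hij)
  | ms3 (a : X) (i j k : Fin n) (hij : i ≠ j) (hik : i ≠ k) (hjk : j ≠ k) :
      RelMixed X n (f i j hij * x a i k hik) (x a j k hjk * f i j hij)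
  /-- Here `k = j` is allowed. -/
  | ms3' (a : X) (i j k : Fin n) (hij : i ≠ j) (hki : k ≠ i) :
      RelMixed X n (f i j hij * x a k i hki) (x a k i hki * e j)
  /-- Here `k = i` is allowed. -/
  | ms4 (a : X) (i j k : Fin n) (hij : i ≠ j) (hkj : k ≠ j) :
      RelMixed X n (f i j hij * x a j k hkj.symm) (f i j hij * f k j hkj)
  | ms4' (a : X) (i j k : Fin n) (hij : i ≠ j) (hki : k ≠ i) (hkj : k ≠ j) :
      RelMixed X n (f i j hij * x a k j hkj) (x a k i hki * f i j hij)
  | ms5 (a : X) (i j k l : Fin n) (hij : i ≠ j) (hkl : k ≠ l)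
      (hdisj : Disjoint ({i, j} : Set (Fin n)) {k, l}) :
      RelMixed X n (f i j hij * x a k l hkl) (x a k l hkl * f i j hij)

/-- All the relations of the presentation of the singular wreath product. -/
def RelMS {X : Type*} (R : FreeMonoid X → FreeMonoid X → Prop) (n : ℕ)
    (u v : FreeSemigroup (Gen X n)) : Prop :=
  RelS X n u v ∨ RelM R n u v ∨ RelMixed X n u v

end SingWreath

namespace SingWreath

open Equiv

/-! That the relations hold in the wreath product is a pointwise check (`relMS_le_ker`). It remains
to show that words with equal images are congruent, and that every element is an image. An element
of the singular wreath product is a permutation `π` of `[n]` with a tuple `b` of labels in `M`, from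
which a nonempty list `L` of points, the holes, has been deleted; only the values of `b` and `π` off
`L` matter (`wreathOf_eq_iff`). The same normal form is built in the presented semigroup.

The letter `f_{i,j}` moves a hole from `i` to `j`. A hole at `k` outside `{i, j}` allows the
transposition of `i` and `j`: carry the hole round the triangle `k, i, j, k`. The resulting element
`holeSwap` depends on the position of the hole, and for `k ∈ {i, j}` it also moves the hole, so a
transposition is not a single element. It does act on families indexed by the position of the hole
(`Stable`), and there the transpositions satisfy defining relations of the symmetric group
(`holeSwap_conj`, `exists_perm_lift`). The labels act on the same families, and together the two
actions obey the relations of the wreath product of `M` with the symmetric group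
(`swapEnd_mul_tupleEnd`). Applying a labelled permutation to the family of idempotents gives
`labelledPerm`.

Multiplying by the idempotents of all holes gives the normal form. The choice of the hole used is
immaterial (`labelledPerm_base`), labels at holes are absorbed, and so are transpositions of two
holes; hence the normal form depends only on its image (`holes_labelledPerm_congr`). Left
multiplication by a letter preserves normal forms, with the same data in both semigroups, so every
word has one (`hasNormalForm`). -/

/-! ### Moves of a hole, and transpositions carried out by means of a hole. -/

/-- The relations between idempotents `E i` and moves `F i j` of a hole from `i` to `j`. -/
structure HoleMoves {S ι : Type*} [Semigroup S] (E : ι → S) (F : ι → ι → S) : Prop where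
  idem : ∀ i, E i * E i = E i
  comm : ∀ i j, E i * E j = E j * E i
  move_back : ∀ i j, i ≠ j → F i j * F j i = E i
  source : ∀ i j, i ≠ j → E i * F i j = F i j
  cube : ∀ i j, i ≠ j → F i j * F i j * F i j = F i j * F i j
  sq : ∀ i j, i ≠ j → F i j * F i j = F j i * F j i
  slide : ∀ i j k, i ≠ j → i ≠ k → j ≠ k → F i j * F i k = F j k * F i j
  triangle : ∀ i j k, i ≠ j → i ≠ k → j ≠ k → F k i * F i j * F j k = F k j * F j i * F i k
  transport : ∀ i j k l, i ≠ j → i ≠ k → i ≠ l → j ≠ k → j ≠ l → k ≠ l →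
    F k i * F i j * F j k * F k l = F k l * F l i * F i j * F j l

/-- The transposition of `i` and `j`, carried out while the hole is at `k`. -/
def holeSwap {S ι : Type*} [Semigroup S] [DecidableEq ι] (E : ι → S) (F : ι → ι → S)
    (k i j : ι) : S :=
  if i = j then E k else if k = i then F i j else if k = j then F j i else F k i * F i j * F j k

section

variable {S ι : Type*} [Semigroup S] [DecidableEq ι] (E : ι → S) (F : ι → ι → S)

theorem holeSwap_self (k i : ι) : holeSwap E F k i i = E k := by simp [holeSwap]

theorem holeSwap_left {i j : ι} (hij : i ≠ j) : holeSwap E F i i j = F i j := by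
  simp [holeSwap, hij]

theorem holeSwap_right {i j : ι} (hij : i ≠ j) : holeSwap E F j i j = F j i := by
  simp [holeSwap, hij, hij.symm]

theorem holeSwap_of_ne {i j k : ι} (hij : i ≠ j) (hki : k ≠ i) (hkj : k ≠ j) :
    holeSwap E F k i j = F k i * F i j * F j k := by
  simp [holeSwap, hij, hki, hkj]

end

namespace HoleMoves

variable {S ι : Type*} [Semigroup S] {E : ι → S} {F : ι → ι → S}

section Basic

variable (h : HoleMoves E F)
include h

theorem target {i j : ι} (hij : i ≠ j) : F i j * E j = F i j := by
  rw [← h.move_back j i hij.symm, ← mul_assoc, h.move_back i j hij, h.source i j hij]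

theorem back_assoc {i j : ι} (hij : i ≠ j) (z : S) : F i j * (F j i * z) = E i * z := by
  rw [← mul_assoc, h.move_back i j hij]

theorem source_assoc {i j : ι} (hij : i ≠ j) (z : S) : E i * (F i j * z) = F i j * z := by
  rw [← mul_assoc, h.source i j hij]

theorem target_assoc {i j : ι} (hij : i ≠ j) (z : S) : F i j * (E j * z) = F i j * z := by
  rw [← mul_assoc, h.target hij]

theorem idem_assoc (i : ι) (z : S) : E i * (E i * z) = E i * z := by
  rw [← mul_assoc, h.idem]

theorem comm_assoc (i j : ι) (z : S) : E i * (E j * z) = E j * (E i * z) := by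
  rw [← mul_assoc, h.comm, mul_assoc]

/-- The square equals the fourth power; reversing the middle two factors by `sq` leaves two round
trips, one from `i` and one from `j`. -/
theorem sq_eq {i j : ι} (hij : i ≠ j) : F i j * F i j = E i * E j :=
  calc F i j * F i j = F i j * F i j * F i j * F i j := by rw [h.cube i j hij, h.cube i j hij]
    _ = F i j * (F i j * F i j) * F i j := by simp only [mul_assoc]
    _ = F i j * F j i * (F j i * F i j) := by rw [h.sq i j hij]; simp only [mul_assoc]
    _ = E i * E j := by rw [h.move_back i j hij, h.move_back j i hij.symm]

theorem off_source {i j : ι} (hij : i ≠ j) : E j * F i j = E i * E j := by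
  rw [← h.move_back j i hij.symm, mul_assoc, h.sq i j hij, ← mul_assoc, h.cube j i hij.symm,
    h.move_back j i hij.symm, ← h.sq i j hij, h.sq_eq hij]

theorem off_target {i j : ι} (hij : i ≠ j) : F i j * E i = E i * E j := by
  rw [← h.move_back i j hij, ← mul_assoc, h.sq i j hij, h.cube j i hij.symm,
    h.move_back i j hij, ← h.sq i j hij, h.sq_eq hij]

/-- Writing `E l` as a round trip through `i` lets `slide` carry each half past the move. -/
theorem idem_move_comm {i j l : ι} (hij : i ≠ j) (hil : i ≠ l) (hjl : j ≠ l) :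
    E l * F i j = F i j * E l := by
  rw [← h.move_back l i hil.symm, mul_assoc, h.slide i l j hil hij hjl.symm, ← mul_assoc,
    h.slide l i j hil.symm hjl.symm hij, mul_assoc]

variable [DecidableEq ι]

/-- Moves conjugate the idempotents as transpositions do; this is how additional holes are tracked.
-/
theorem idem_mul_move {i j : ι} (hij : i ≠ j) (l : ι) :
    E l * F i j = F i j * E (swap i j l) := by
  by_cases hi : l = i
  · rw [hi, swap_apply_left, h.source i j hij, h.target hij]
  by_cases hj : l = j
  · rw [hj, swap_apply_right, h.off_source hij, h.off_target hij]
  rw [swap_apply_of_ne_of_ne hi hj, h.idem_move_comm hij (Ne.symm hi) (Ne.symm hj)]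

theorem holeSwap_comm (k i j : ι) : holeSwap E F k i j = holeSwap E F k j i := by
  by_cases hij : i = j
  · rw [hij]
  by_cases hi : k = i
  · rw [hi, holeSwap_left E F hij, holeSwap_right E F (Ne.symm hij)]
  by_cases hj : k = j
  · rw [hj, holeSwap_left E F (Ne.symm hij), holeSwap_right E F hij]
  rw [holeSwap_of_ne E F hij hi hj, holeSwap_of_ne E F (Ne.symm hij) hj hi,
    h.triangle i j k hij (Ne.symm hi) (Ne.symm hj)]

theorem source_holeSwap (k i j : ι) : E k * holeSwap E F k i j = holeSwap E F k i j := by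
  by_cases hij : i = j
  · rw [hij, holeSwap_self E F, h.idem]
  by_cases hi : k = i
  · rw [hi, holeSwap_left E F hij, h.source i j hij]
  by_cases hj : k = j
  · rw [hj, holeSwap_right E F hij, h.source j i (Ne.symm hij)]
  rw [holeSwap_of_ne E F hij hi hj, ← mul_assoc, ← mul_assoc, h.source k i hi]

theorem idem_mul_holeSwap (k i j l : ι) :
    E l * holeSwap E F k i j = holeSwap E F k i j * E (swap i j l) := by
  by_cases hij : i = j
  · rw [hij, holeSwap_self E F, h.comm, swap_self, refl_apply]
  by_cases hi : k = i
  · rw [hi, holeSwap_left E F hij, h.idem_mul_move hij]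
  by_cases hj : k = j
  · rw [hj, holeSwap_right E F hij, h.idem_mul_move (Ne.symm hij), swap_comm]
  -- Going round the triangle `k, i, j, k` permutes all the points as the transposition of `i` and
  -- `j` does.
  have hs : swap i j l = swap j k (swap i j (swap k i l)) := by
    simp only [swap_apply_def]; grind
  rw [holeSwap_of_ne E F hij hi hj, ← mul_assoc, ← mul_assoc, h.idem_mul_move hi, mul_assoc (F k i),
    h.idem_mul_move hij, mul_assoc, mul_assoc, mul_assoc, h.idem_mul_move (Ne.symm hj), ← hs]
  simp only [mul_assoc]

theorem holeSwap_mul_self (k i j : ι) :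
    holeSwap E F k i j * holeSwap E F (swap i j k) i j = E k := by
  by_cases hij : i = j
  · rw [hij, swap_self, refl_apply, holeSwap_self E F, h.idem]
  by_cases hi : k = i
  · rw [hi, holeSwap_left E F hij, swap_apply_left, holeSwap_right E F hij, h.move_back i j hij]
  by_cases hj : k = j
  · rw [hj, holeSwap_right E F hij, swap_apply_right, holeSwap_left E F hij,
      h.move_back j i (Ne.symm hij)]
  rw [swap_apply_of_ne_of_ne hi hj]
  nth_rw 2 [h.holeSwap_comm]
  rw [holeSwap_of_ne E F hij hi hj, holeSwap_of_ne E F (Ne.symm hij) hj hi]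
  simp only [mul_assoc]
  rw [h.back_assoc (Ne.symm hj), h.source_assoc (Ne.symm hij), h.back_assoc hij,
    h.source i k (Ne.symm hi), h.move_back k i hi]

/-- A transposition fixing both ends of a move commutes with the move. -/
theorem holeSwap_mul_move {p l i j : ι} (hij : i ≠ j) (hpi : p ≠ i) (hpj : p ≠ j) (hli : l ≠ i)
    (hlj : l ≠ j) (hpl : p ≠ l) :
    holeSwap E F p i j * F p l = F p l * holeSwap E F l i j := by
  rw [holeSwap_of_ne E F hij hpi hpj, holeSwap_of_ne E F hij hli hlj,
    h.transport i j p l hij hpi.symm hli.symm hpj.symm hlj.symm hpl]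
  simp only [mul_assoc]

/-- If the hole is outside `{i, j, l}`, route the second transposition through `F p l` and carry the
first past that move by `holeSwap_mul_move`; the round trips then cancel. The other positions of the
hole are direct. -/
theorem holeSwap_braid (p : ι) {i j l : ι} (hij : i ≠ j) (hil : i ≠ l) (hjl : j ≠ l) :
    holeSwap E F p i j * holeSwap E F (swap i j p) j l =
      holeSwap E F p i l * holeSwap E F (swap i l p) i j := by
  by_cases hi : p = i
  · rw [hi, swap_apply_left, swap_apply_left, holeSwap_left E F hij, holeSwap_left E F hil,
      holeSwap_left E F hjl, holeSwap_of_ne E F hij hil.symm hjl.symm, mul_assoc (F l i),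
      h.back_assoc hil, ← mul_assoc, h.source i j hij]
  by_cases hj : p = j
  · rw [hj, swap_apply_right, swap_apply_of_ne_of_ne hij.symm hjl, holeSwap_right E F hij,
      holeSwap_of_ne E F hjl hij hil, h.holeSwap_comm j i l,
      holeSwap_of_ne E F hil.symm hjl hij.symm]
    simp only [mul_assoc]
    rw [h.back_assoc hij.symm, h.move_back i j hij, h.target hil.symm, h.source_assoc hjl]
  by_cases hl : p = l
  · rw [hl, swap_apply_right, swap_apply_of_ne_of_ne hil.symm hjl.symm, holeSwap_right E F hjl,
      holeSwap_of_ne E F hij hil.symm hjl.symm, holeSwap_right E F hil, holeSwap_left E F hij,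
      mul_assoc, h.move_back j l hjl, mul_assoc, h.target hij]
  rw [swap_apply_of_ne_of_ne hi hj, swap_apply_of_ne_of_ne hi hl, h.holeSwap_comm p j l,
    holeSwap_of_ne E F hjl.symm hl hj, ← mul_assoc, ← mul_assoc,
    h.holeSwap_mul_move hij hi hj hil.symm hjl.symm hl, holeSwap_of_ne E F hij hil.symm hjl.symm,
    h.holeSwap_comm p i l, holeSwap_of_ne E F hil.symm hl hi, holeSwap_of_ne E F hij hi hj]
  simp only [mul_assoc]
  rw [h.back_assoc hjl, h.source j p (Ne.symm hj), h.back_assoc (Ne.symm hi),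
    h.source_assoc hij]

theorem holeSwap_disjoint_of_ne (p : ι) {i j k l : ι} (hij : i ≠ j) (hik : i ≠ k) (hil : i ≠ l)
    (hjk : j ≠ k) (hjl : j ≠ l) (hkl : k ≠ l) (hpk : p ≠ k) (hpl : p ≠ l) :
    holeSwap E F p i j * holeSwap E F (swap i j p) k l =
      holeSwap E F p k l * holeSwap E F p i j := by
  by_cases hi : p = i
  · rw [hi, swap_apply_left, holeSwap_left E F hij, h.holeSwap_mul_move hkl hik hil hjk hjl hij]
  by_cases hj : p = j
  · rw [hj, swap_apply_right, holeSwap_right E F hij,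
      h.holeSwap_mul_move hkl hjk hjl hik hil hij.symm]
  rw [swap_apply_of_ne_of_ne hi hj, holeSwap_of_ne E F hij hi hj, mul_assoc, mul_assoc,
    ← h.holeSwap_mul_move hkl hjk hjl hpk hpl (Ne.symm hj), ← mul_assoc (F i j),
    ← h.holeSwap_mul_move hkl hik hil hjk hjl hij, mul_assoc, ← mul_assoc (F p i),
    ← h.holeSwap_mul_move hkl hpk hpl hik hil hi]
  simp only [mul_assoc]

/-- The hole lies in at most one of the two disjoint pairs, so by symmetry `holeSwap_disjoint_of_ne`
covers every case. -/
theorem holeSwap_disjoint (p : ι) {i j k l : ι} (hij : i ≠ j) (hik : i ≠ k) (hil : i ≠ l)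
    (hjk : j ≠ k) (hjl : j ≠ l) (hkl : k ≠ l) :
    holeSwap E F p i j * holeSwap E F (swap i j p) k l =
      holeSwap E F p k l * holeSwap E F (swap k l p) i j := by
  by_cases hp : p = k ∨ p = l
  · have hi : p ≠ i := by grind
    have hj : p ≠ j := by grind
    rw [h.holeSwap_disjoint_of_ne p hkl hik.symm hjk.symm hil.symm hjl.symm hij hi hj,
      swap_apply_of_ne_of_ne hi hj]
  · push Not at hp
    rw [h.holeSwap_disjoint_of_ne p hij hik hil hjk hjl hkl hp.1 hp.2,
      swap_apply_of_ne_of_ne hp.1 hp.2]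

theorem holeSwap_conj_left (p : ι) {i j l : ι} (hij : i ≠ j) (k : ι) (hli : l ≠ i) (hlj : l ≠ j)
    (hkl : k ≠ l) :
    holeSwap E F p i j * holeSwap E F (swap i j p) k l =
      holeSwap E F p (swap i j k) (swap i j l) *
        holeSwap E F (swap (swap i j k) (swap i j l) p) i j := by
  rw [swap_apply_of_ne_of_ne hli hlj]
  by_cases hki : k = i
  · rw [hki, swap_apply_left, h.holeSwap_comm p i j, swap_comm i j,
      h.holeSwap_braid p hij.symm hlj.symm hli.symm, h.holeSwap_comm _ j i]
  by_cases hkj : k = j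
  · rw [hkj, swap_apply_right, h.holeSwap_braid p hij hli.symm hlj.symm]
  rw [swap_apply_of_ne_of_ne hki hkj]
  exact h.holeSwap_disjoint p hij (Ne.symm hki) hli.symm (Ne.symm hkj) hlj.symm hkl

/-- The conjugation relation between transpositions, each factor being taken at the position where
the previous one left the hole. The pairs may coincide, share one point (`holeSwap_braid`) or be
disjoint. -/
theorem holeSwap_conj (p i j k l : ι) :
    holeSwap E F p i j * holeSwap E F (swap i j p) k l =
      holeSwap E F p (swap i j k) (swap i j l) *
        holeSwap E F (swap (swap i j k) (swap i j l) p) i j := by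
  by_cases hij : i = j
  · subst hij
    simp only [swap_self, refl_apply, holeSwap_self E F, h.source_holeSwap]
    rw [← h.idem_mul_holeSwap p k l p, h.source_holeSwap]
  by_cases hkl : k = l
  · subst hkl
    simp only [swap_self, refl_apply, holeSwap_self E F, h.source_holeSwap]
    rw [← h.idem_mul_holeSwap p i j p, h.source_holeSwap]
  by_cases hl : l ≠ i ∧ l ≠ j
  · exact h.holeSwap_conj_left p hij k hl.1 hl.2 hkl
  by_cases hk : k ≠ i ∧ k ≠ j
  · rw [h.holeSwap_comm _ k l, h.holeSwap_comm _ (swap i j k), swap_comm (swap i j k)]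
    exact h.holeSwap_conj_left p hij l hk.1 hk.2 (Ne.symm hkl)
  obtain ⟨rfl, rfl⟩ | ⟨rfl, rfl⟩ : k = i ∧ l = j ∨ k = j ∧ l = i := by grind
  · rw [swap_apply_left, swap_apply_right, h.holeSwap_comm p l k, swap_comm l k]
  · rw [swap_apply_left, swap_apply_right, h.holeSwap_comm _ k l]

theorem idem_mul_holeSwap_of_ne {i j k : ι} (hij : i ≠ j) (hki : k ≠ i) (hkj : k ≠ j) :
    E i * holeSwap E F k i j = E k * F i j := by
  rw [holeSwap_of_ne E F hij hki hkj, ← mul_assoc, ← mul_assoc, h.off_source hki, h.comm k i,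
    mul_assoc, mul_assoc, ← mul_assoc (E k), h.idem_move_comm hij hki.symm hkj.symm, mul_assoc,
    h.off_source hkj.symm, ← mul_assoc, ← mul_assoc, h.source i j hij, mul_assoc,
    h.target_assoc hij]

/-- Changing the hole at which a transposition is carried out. -/
theorem idem_mul_holeSwap_base (p q i j : ι) :
    E p * holeSwap E F q i j = E q * holeSwap E F p i j := by
  by_cases hij : i = j
  · rw [hij, holeSwap_self E F, holeSwap_self E F, h.comm]
  by_cases hpq : p = q
  · rw [hpq]
  -- One of the two holes is itself a point to be transposed.
  have end_ : ∀ {i j q : ι}, i ≠ j → q ≠ i →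
      E i * holeSwap E F q i j = E q * holeSwap E F i i j := by
    intro i j q hij hqi
    rw [holeSwap_left E F hij]
    by_cases hqj : q = j
    · rw [hqj, holeSwap_right E F hij, h.off_source hij, h.off_source hij.symm, h.comm]
    · exact h.idem_mul_holeSwap_of_ne hij hqi hqj
  by_cases hpi : p = i
  · rw [hpi]; exact end_ hij (hpi ▸ Ne.symm hpq)
  by_cases hqi : q = i
  · rw [hqi]; exact (end_ hij hpi).symm
  by_cases hpj : p = j
  · rw [hpj, h.holeSwap_comm, h.holeSwap_comm j]; exact end_ (Ne.symm hij) (hpj ▸ Ne.symm hpq)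
  by_cases hqj : q = j
  · rw [hqj, h.holeSwap_comm, h.holeSwap_comm p]; exact (end_ (Ne.symm hij) hpj).symm
  -- With a second hole at `q`, the move `F p q` degenerates to the idempotent `E p * E q`, so
  -- commuting past it becomes a change of hole.
  have key := congrArg (E q * ·) (h.holeSwap_mul_move hij hpi hpj hqi hqj hpq)
  simp only [← mul_assoc, h.off_source hpq] at key
  have hp : holeSwap E F p i j * E p = holeSwap E F p i j := by
    nth_rw 2 [← h.source_holeSwap]
    rw [h.idem_mul_holeSwap, swap_apply_of_ne_of_ne hpi hpj]
  rw [h.idem_mul_holeSwap, swap_apply_of_ne_of_ne hqi hqj, mul_assoc, h.off_source hpq,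
    ← mul_assoc, hp, mul_assoc, h.source_holeSwap] at key
  rw [← key, h.idem_mul_holeSwap, swap_apply_of_ne_of_ne hqi hqj]

end Basic
end HoleMoves

/-! ### The symmetric group generated by its transpositions. -/

/-- The symmetric group is presented, as a monoid, by its transpositions. -/
theorem exists_perm_lift {N : Type*} [Monoid N] : ∀ {n : ℕ} (T : Fin n → Fin n → N),
    (∀ i, T i i = 1) → (∀ i j, T i j = T j i) → (∀ i j, T i j * T i j = 1) →
    (∀ i j k l, T i j * T k l = T (swap i j k) (swap i j l) * T i j) →
    ∃ ρ : Perm (Fin n) → N, ρ 1 = 1 ∧ ∀ i j π, ρ (swap i j * π) = T i j * ρ π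
  | 0, _, _, _, _, _ => ⟨fun _ => 1, rfl, fun i => i.elim0⟩
  | n + 1, T, hone, hsymm, hsq, hconj => by
    obtain ⟨ρ, hρ1, hρ⟩ := exists_perm_lift (fun i j : Fin n => T i.succ j.succ)
      (fun i => hone _) (fun i j => hsymm _ _) (fun i j => hsq _ _) (fun i j k l => by
        rw [hconj, ← (Fin.succ_injective n).swap_apply, ← (Fin.succ_injective n).swap_apply])
    -- Coset decomposition: `π` is the transposition of `0` and `π 0`, times a permutation fixing
    -- `0`, to which the induction applies.
    refine ⟨fun π => T 0 (Perm.decomposeFin π).1 * ρ (Perm.decomposeFin π).2, ?_, ?_⟩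
    · have h1 : (1 : Perm (Fin (n + 1))) = Perm.decomposeFin.symm (0, 1) := by simp; rfl
      rw [h1]
      change T 0 (Perm.decomposeFin (Perm.decomposeFin.symm (0, 1))).1 * ρ _ = 1
      rw [ apply_symm_apply, hone, hρ1, one_mul]
    have hsucc : ∀ (i j : Fin n) p e, swap i.succ j.succ * Perm.decomposeFin.symm (p, e) =
        Perm.decomposeFin.symm (swap i.succ j.succ p, swap i j * e) := by
      intro i j p e
      ext x : 1
      refine Fin.cases ?_ (fun x => ?_) x
      · simp
      · simp only [Perm.mul_apply, Perm.decomposeFin_symm_apply_succ,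
          ← (Fin.succ_injective n).swap_apply]
        have h0 : swap i.succ j.succ 0 = 0 :=
          swap_apply_of_ne_of_ne (Fin.succ_ne_zero i).symm (Fin.succ_ne_zero j).symm
        nth_rw 2 [← h0]
        rw [(swap i.succ j.succ).injective.swap_apply]
    have hzero : ∀ (j : Fin n) p e, T 0 j.succ * (T 0 p * ρ e) =
        T 0 (Perm.decomposeFin (swap 0 j.succ * Perm.decomposeFin.symm (p, e))).1 *
          ρ (Perm.decomposeFin (swap 0 j.succ * Perm.decomposeFin.symm (p, e))).2 := by
      intro j p e
      refine Fin.cases ?_ (fun a => ?_) p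
      · have : swap 0 j.succ * Perm.decomposeFin.symm (0, e) =
            Perm.decomposeFin.symm (j.succ, e) := by
          ext x : 1
          refine Fin.cases ?_ (fun x => ?_) x <;> simp
        rw [this, apply_symm_apply, hone, one_mul]
      by_cases hja : j = a
      · have : swap 0 j.succ * Perm.decomposeFin.symm (a.succ, e) =
            Perm.decomposeFin.symm (0, e) := by
          ext x : 1
          refine Fin.cases ?_ (fun x => ?_) x <;> simp [hja]
        rw [this, apply_symm_apply, hone, one_mul, hja, ← mul_assoc, hsq, one_mul]
      · have : swap 0 j.succ * Perm.decomposeFin.symm (a.succ, e) =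
            Perm.decomposeFin.symm (a.succ, swap j a * e) := by
          ext x : 1
          refine Fin.cases ?_ (fun x => ?_) x
          · simp [swap_apply_def, Ne.symm hja]
          · simp only [Perm.mul_apply, Perm.decomposeFin_symm_apply_succ, swap_apply_def]
            grind
        -- Conjugating twice turns `(0 j)(0 a)` into `(j a)(0 j)` and then into `(0 a)(j a)`, which
        -- has the coset representative in front.
        have h0 := hconj 0 j.succ 0 a.succ
        have h1 := hconj j.succ a.succ 0 j.succ
        rw [swap_apply_left, swap_apply_of_ne_of_ne (Fin.succ_ne_zero a)
          (fun hh => hja (Fin.succ_injective n hh).symm)] at h0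
        rw [swap_apply_left, swap_apply_of_ne_of_ne (Fin.succ_ne_zero j).symm
          (Fin.succ_ne_zero a).symm] at h1
        rw [this, apply_symm_apply, hρ, ← mul_assoc, ← mul_assoc, h0, h1]
    have main : ∀ i j p e, T i j * (T 0 p * ρ e) =
        T 0 (Perm.decomposeFin (swap i j * Perm.decomposeFin.symm (p, e))).1 *
          ρ (Perm.decomposeFin (swap i j * Perm.decomposeFin.symm (p, e))).2 := by
      intro i j p e
      refine Fin.cases ?_ (fun i => ?_) i
      · refine Fin.cases ?_ (fun j => hzero j p e) j
        rw [swap_self, ← Perm.one_def, one_mul, apply_symm_apply, hone, one_mul]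
      refine Fin.cases ?_ (fun j => ?_) j
      · rw [hsymm, swap_comm]
        exact hzero i p e
      · rw [hsucc, apply_symm_apply, hρ, ← mul_assoc, ← mul_assoc, hconj,
          swap_apply_of_ne_of_ne (Fin.succ_ne_zero i).symm (Fin.succ_ne_zero j).symm]
    intro i j π
    have := main i j (Perm.decomposeFin π).1 (Perm.decomposeFin π).2
    rw [Prod.mk.eta, symm_apply_apply] at this
    exact this.symm

/-! ### Labels, and the action of labelled permutations on families indexed by the hole. -/

/-- The relations between the idempotents `E k`, the moves `F i j` of a hole, and the elements
`D k i a`, which put the label `a` at `i` while there is a hole at `k`. -/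
structure HoleLabels {S ι M : Type*} [Semigroup S] [Monoid M] [DecidableEq ι] (E : ι → S)
    (F : ι → ι → S) (D : ι → ι → M → S) : Prop extends HoleMoves E F where
  label_one : ∀ k i, D k i 1 = E k
  label_mul : ∀ k i a b, D k i (a * b) = D k i a * D k i b
  label_self : ∀ k a, D k k a = E k
  label_comm : ∀ k i j a b, i ≠ j → D k i a * D k j b = D k j b * D k i a
  label_base : ∀ j k i a, E j * D k i a = E k * D j i a
  idem_mul_label : ∀ j k i a, E j * D k i a = D k i a * E j
  move_mul_label : ∀ i j l a, i ≠ j → F i j * D j l a = D i (swap i j l) a * F i j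

/-- Families that are stable under the idempotents `E k`. -/
abbrev Stable {S ι : Type*} [Semigroup S] (E : ι → S) : Type _ :=
  {z : ι → S // ∀ k, E k * z k = z k}

namespace HoleLabels

variable {S M : Type*} [Semigroup S] [Monoid M] {n : ℕ} {E : Fin n → S} {F : Fin n → Fin n → S}
  {D : Fin n → Fin n → M → S} (h : HoleLabels E F D)
include h

theorem source_label (k i : Fin n) (a : M) : E k * D k i a = D k i a := by
  rw [← h.label_one k i, ← h.label_mul, one_mul]

theorem holeSwap_mul_label (k i j l : Fin n) (a : M) :
    holeSwap E F k i j * D (swap i j k) l a = D k (swap i j l) a * holeSwap E F k i j := by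
  by_cases hij : i = j
  · simp only [hij, holeSwap_self, swap_self, refl_apply, h.idem_mul_label]
  by_cases hi : k = i
  · rw [hi, holeSwap_left E F hij, swap_apply_left, h.move_mul_label _ _ _ _ hij]
  by_cases hj : k = j
  · rw [hj, holeSwap_right E F hij, swap_apply_right, h.move_mul_label _ _ _ _ (Ne.symm hij),
      swap_comm]
  have hs : swap i j l = swap k i (swap i j (swap j k l)) := by
    simp only [swap_apply_def]; grind
  rw [holeSwap_of_ne E F hij hi hj, swap_apply_of_ne_of_ne hi hj, mul_assoc,
    h.move_mul_label _ _ _ _ (Ne.symm hj), mul_assoc, ← mul_assoc (F i j),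
    h.move_mul_label _ _ _ _ hij, ← mul_assoc (F k i), ← mul_assoc (F k i),
    h.move_mul_label _ _ _ _ hi, hs]
  simp only [mul_assoc]

/-- The transposition of `i` and `j`, acting on stable families. -/
def swapEnd (i j : Fin n) : Function.End (Stable E) := fun z =>
  ⟨fun k => holeSwap E F k i j * z.1 (swap i j k), fun k => by
    rw [← mul_assoc, h.source_holeSwap]⟩

/-- The labels at `i`, acting on stable families. -/
def labelEnd (i : Fin n) : M →* Function.End (Stable E) where
  toFun a z := ⟨fun k => D k i a * z.1 k, fun k => by rw [← mul_assoc, h.source_label]⟩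
  map_one' := by
    funext z
    refine Subtype.ext (funext fun k => ?_)
    change D k i 1 * z.1 k = z.1 k
    rw [h.label_one, z.2]
  map_mul' a b := by
    funext z
    refine Subtype.ext (funext fun k => ?_)
    change D k i (a * b) * z.1 k = D k i a * (D k i b * z.1 k)
    rw [h.label_mul, mul_assoc]

theorem exists_permEnd : ∃ ρ : Perm (Fin n) → Function.End (Stable E), ρ 1 = 1 ∧
    ∀ i j π, ρ (swap i j * π) = h.swapEnd i j * ρ π := by
  refine exists_perm_lift _ ?_ ?_ ?_ ?_
  · intro i
    funext z
    refine Subtype.ext (funext fun k => ?_)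
    change holeSwap E F k i i * z.1 (swap i i k) = z.1 k
    rw [swap_self, refl_apply, holeSwap_self E F, z.2]
  · intro i j
    funext z
    refine Subtype.ext (funext fun k => ?_)
    change holeSwap E F k i j * z.1 (swap i j k) = holeSwap E F k j i * z.1 (swap j i k)
    rw [swap_comm, h.holeSwap_comm]
  · intro i j
    funext z
    refine Subtype.ext (funext fun k => ?_)
    change holeSwap E F k i j * (holeSwap E F (swap i j k) i j * z.1 (swap i j (swap i j k))) =
      z.1 k
    rw [← mul_assoc, h.holeSwap_mul_self, swap_apply_self, z.2]
  · intro i j k l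
    funext z
    refine Subtype.ext (funext fun p => ?_)
    change holeSwap E F p i j * (holeSwap E F (swap i j p) k l * z.1 (swap k l (swap i j p))) =
      holeSwap E F p (swap i j k) (swap i j l) *
        (holeSwap E F (swap (swap i j k) (swap i j l) p) i j *
          z.1 (swap i j (swap (swap i j k) (swap i j l) p)))
    have hs := (swap i j).injective.swap_apply (swap i j k) (swap i j l) p
    rw [swap_apply_self, swap_apply_self] at hs
    rw [← mul_assoc, ← mul_assoc, h.holeSwap_conj, hs]

theorem labelEnd_commute :
    Pairwise fun i j => ∀ a b, Commute (h.labelEnd i a) (h.labelEnd j b) := by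
  intro i j hij a b
  funext z
  refine Subtype.ext (funext fun k => ?_)
  change D k i a * (D k j b * z.1 k) = D k j b * (D k i a * z.1 k)
  rw [← mul_assoc, h.label_comm k i j a b hij, mul_assoc]

/-- The action of tuples of labels on stable families. -/
noncomputable def tupleEnd : (Fin n → M) →* Function.End (Stable E) :=
  MonoidHom.noncommPiCoprod h.labelEnd h.labelEnd_commute

theorem tupleEnd_mulSingle (i : Fin n) (a : M) :
    h.tupleEnd (Pi.mulSingle i a) = h.labelEnd i a := by
  rw [tupleEnd, MonoidHom.noncommPiCoprod_mulSingle]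

end HoleLabels

/-- Every tuple is a product of tuples with one nontrivial entry. -/
theorem tuple_induction {M : Type*} [Monoid M] {n : ℕ} {p : (Fin n → M) → Prop} (one : p 1)
    (mul : ∀ i a b, p b → p (Pi.mulSingle i a * b)) (b : Fin n → M) : p b := by
  have key : ∀ s : Finset (Fin n), p (s.piecewise b 1) := by
    intro s
    induction s using Finset.induction_on with
    | empty => simpa using one
    | insert i s hi ih =>
      convert mul i (b i) _ ih using 1
      funext j
      by_cases hj : j = i
      · subst hj; simp [hi]
      · simp [Finset.piecewise, hj]
  simpa using key Finset.univ

namespace HoleLabels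

variable {S M : Type*} [Semigroup S] [Monoid M] {n : ℕ} {E : Fin n → S} {F : Fin n → Fin n → S}
  {D : Fin n → Fin n → M → S} (h : HoleLabels E F D)
include h

/-- The semidirect product relation: a transposition permutes the coordinates of the tuple. It
reduces to one label at a time, where it is `holeSwap_mul_label`. -/
theorem swapEnd_mul_tupleEnd (i j : Fin n) (b : Fin n → M) :
    h.swapEnd i j * h.tupleEnd b = h.tupleEnd (b ∘ swap i j) * h.swapEnd i j := by
  induction b using tuple_induction with
  | one =>
    have : (1 : Fin n → M) ∘ swap i j = 1 := rfl
    rw [this, map_one, one_mul, mul_one]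
  | mul l a b ih =>
    have h1 : (Pi.mulSingle l a * b) ∘ swap i j =
        Pi.mulSingle (swap i j l) a * (b ∘ swap i j) := by
      funext k
      by_cases hk : swap i j k = l
      · subst hk; simp
      · have : k ≠ swap i j l := fun hh => hk (by rw [hh, swap_apply_self])
        simp [Pi.mulSingle_eq_of_ne hk, Pi.mulSingle_eq_of_ne this]
    rw [h1, map_mul, map_mul, mul_assoc, ← ih, ← mul_assoc, ← mul_assoc]
    congr 1
    rw [h.tupleEnd_mulSingle, h.tupleEnd_mulSingle]
    funext z
    refine Subtype.ext (funext fun k => ?_)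
    change holeSwap E F k i j * (D (swap i j k) l a * z.1 (swap i j k)) =
      D k (swap i j l) a * (holeSwap E F k i j * z.1 (swap i j k))
    rw [← mul_assoc, h.holeSwap_mul_label, mul_assoc]

/-- The elements `C k b π`: the permutation `π` with labels `b`, with a hole at `k`. -/
theorem exists_labelledPerm : ∃ C : Fin n → (Fin n → M) → Perm (Fin n) → S,
    (∀ k b π, E k * C k b π = C k b π) ∧ (∀ k, C k 1 1 = E k) ∧
    (∀ k i a b π, D k i a * C k b π = C k (Pi.mulSingle i a * b) π) ∧
    (∀ k i j b π, holeSwap E F k i j * C (swap i j k) b π =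
      C k (b ∘ swap i j) (π * swap i j)) := by
  obtain ⟨ρ, hρ1, hρ⟩ := h.exists_permEnd
  -- The inverse reconciles left-to-right composition of partial maps with right-to-left composition
  -- in `Perm`: a transposition multiplying on the left must become `π * swap i j`.
  refine ⟨fun k b π => (h.tupleEnd b (ρ π⁻¹ ⟨E, h.idem⟩)).1 k, ?_, ?_, ?_, ?_⟩
  · intro k b π
    exact (h.tupleEnd b (ρ π⁻¹ ⟨E, h.idem⟩)).2 k
  · intro k
    beta_reduce
    rw [inv_one, hρ1, map_one]
    rfl
  · intro k i a b π
    beta_reduce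
    rw [map_mul, h.tupleEnd_mulSingle]
    rfl
  · intro k i j b π
    have h1 := congrArg (fun g : Function.End (Stable E) => (g (ρ π⁻¹ ⟨E, h.idem⟩)).1 k)
      (h.swapEnd_mul_tupleEnd i j b)
    beta_reduce
    rw [mul_inv_rev, swap_inv, hρ]
    exact h1

end HoleLabels

/-! ### Normal forms with several holes. -/

/-- The product of the idempotents `E i` for `i` in the list `L`, times `z`. -/
def holes {S ι : Type*} [Semigroup S] (E : ι → S) (L : List ι) (z : S) : S :=
  L.foldr (fun i y => E i * y) z

theorem holes_cons {S ι : Type*} [Semigroup S] (E : ι → S) (i : ι) (L : List ι) (z : S) :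
    holes E (i :: L) z = E i * holes E L z := rfl

theorem mul_holes {S ι : Type*} [Semigroup S] {E : ι → S} {a : S} {g : ι → ι}
    (ha : ∀ i, a * E i = E (g i) * a) (L : List ι) (z : S) :
    a * holes E L z = holes E (L.map g) (a * z) := by
  induction L with
  | nil => rfl
  | cons i L ih =>
    rw [List.map_cons, holes_cons, holes_cons, ← ih, ← mul_assoc, ha, mul_assoc]

namespace HoleMoves

variable {S ι : Type*} [Semigroup S] {E : ι → S} {F : ι → ι → S} (h : HoleMoves E F)
include h

theorem idem_mul_holes (i : ι) (L : List ι) (z : S) :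
    E i * holes E L z = holes E L (E i * z) := by
  simpa using mul_holes (g := id) (fun j => h.comm i j) L z

theorem idem_mul_holes_of_mem {i : ι} {L : List ι} (hi : i ∈ L) (z : S) :
    E i * holes E L z = holes E L z := by
  induction L with
  | nil => simp at hi
  | cons j L ih =>
    rw [holes_cons]
    rcases List.mem_cons.mp hi with rfl | hi
    · rw [h.idem_assoc]
    · rw [h.comm_assoc, ih hi]

theorem holes_idem {i : ι} {L : List ι} (hi : i ∈ L) (z : S) :
    holes E L (E i * z) = holes E L z := by
  rw [← h.idem_mul_holes, h.idem_mul_holes_of_mem hi]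

/-- Idempotence and commutativity: the products over `L` and `L'` commute, and each absorbs the
other. -/
theorem holes_congr {L L' : List ι} (hL : ∀ i, i ∈ L ↔ i ∈ L') (z : S) :
    holes E L z = holes E L' z := by
  have key : ∀ {L L' : List ι}, (∀ i ∈ L, i ∈ L') → holes E L (holes E L' z) = holes E L' z := by
    intro L L' hL
    induction L with
    | nil => rfl
    | cons i L ih =>
      rw [holes_cons, ih fun j hj => hL j (List.mem_cons_of_mem _ hj),
        h.idem_mul_holes_of_mem (hL i List.mem_cons_self)]
  have swap_ : ∀ {L L' : List ι}, holes E L (holes E L' z) = holes E L' (holes E L z) := by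
    intro L L'
    induction L with
    | nil => rfl
    | cons i L ih => rw [holes_cons, ih, h.idem_mul_holes, ← holes_cons]
  rw [← key fun i hi => (hL i).mpr hi, swap_, key fun i hi => (hL i).mp hi]

theorem idem_mul_idem_mul_holeSwap [DecidableEq ι] {i j : ι} (hij : i ≠ j) (k : ι) :
    E i * (E j * holeSwap E F k i j) = E i * (E j * E k) := by
  rw [h.comm_assoc, h.idem_mul_holeSwap_base, holeSwap_left E F hij, h.comm_assoc,
    h.off_source hij, ← h.comm_assoc, h.comm k j]

end HoleMoves

namespace HoleLabels

variable {S M : Type*} [Semigroup S] [Monoid M] {n : ℕ} {E : Fin n → S} {F : Fin n → Fin n → S}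
  {D : Fin n → Fin n → M → S} (h : HoleLabels E F D)

/-- The permutation `π` with labels `b`, with a hole at `k`. -/
noncomputable def labelledPerm (k : Fin n) (b : Fin n → M) (π : Perm (Fin n)) : S :=
  h.exists_labelledPerm.choose k b π

theorem idem_mul_labelledPerm (k : Fin n) (b : Fin n → M) (π : Perm (Fin n)) :
    E k * h.labelledPerm k b π = h.labelledPerm k b π :=
  h.exists_labelledPerm.choose_spec.1 k b π

theorem labelledPerm_one (k : Fin n) : h.labelledPerm k 1 1 = E k :=
  h.exists_labelledPerm.choose_spec.2.1 k

theorem label_mul_labelledPerm (k i : Fin n) (a : M) (b : Fin n → M) (π : Perm (Fin n)) :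
    D k i a * h.labelledPerm k b π = h.labelledPerm k (Pi.mulSingle i a * b) π :=
  h.exists_labelledPerm.choose_spec.2.2.1 k i a b π

theorem holeSwap_mul_labelledPerm (k i j : Fin n) (b : Fin n → M) (π : Perm (Fin n)) :
    holeSwap E F k i j * h.labelledPerm (swap i j k) b π =
      h.labelledPerm k (b ∘ swap i j) (π * swap i j) :=
  h.exists_labelledPerm.choose_spec.2.2.2 k i j b π

theorem labelledPerm_mul_swap (k i j : Fin n) (b : Fin n → M) (π : Perm (Fin n)) :
    h.labelledPerm k b (π * swap i j) =
      holeSwap E F k i j * h.labelledPerm (swap i j k) (b ∘ swap i j) π := by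
  rw [h.holeSwap_mul_labelledPerm]
  congr 1
  funext l
  simp

theorem labelledPerm_base (j k : Fin n) (b : Fin n → M) (π : Perm (Fin n)) :
    E j * h.labelledPerm k b π = E k * h.labelledPerm j b π := by
  induction π using Perm.swap_induction_on' generalizing j k b with
  | one =>
    induction b using tuple_induction with
    | one => rw [h.labelledPerm_one, h.labelledPerm_one, h.comm]
    | mul i a b ih =>
      -- The induction hypothesis changes the hole in the labelled permutation; reinserting `E j`
      -- then allows `label_base` to change it in the label.
      rw [← h.label_mul_labelledPerm, ← h.label_mul_labelledPerm, ← mul_assoc, h.idem_mul_label,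
        mul_assoc, ih, ← mul_assoc, ← h.idem_mul_label, mul_assoc,
        ← h.idem_mul_labelledPerm j b 1, ← mul_assoc (D k i a), ← h.idem_mul_label,
        h.label_base, mul_assoc, h.idem_assoc, h.idem_mul_labelledPerm]
  | mul_swap π i l hil ih =>
    rw [h.labelledPerm_mul_swap, h.labelledPerm_mul_swap, ← mul_assoc, h.idem_mul_holeSwap,
      mul_assoc, ih, ← mul_assoc, ← h.idem_mul_holeSwap, h.source_holeSwap, ← mul_assoc,
      ← h.idem_mul_holeSwap_base, h.idem_mul_holeSwap, mul_assoc, h.idem_mul_labelledPerm]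

/-- Split off the label at `i`: changing its hole to `i` turns it into an idempotent, by
`label_self`. -/
theorem idem_mul_labelledPerm_update (i k : Fin n) (b : Fin n → M) (π : Perm (Fin n)) :
    E i * h.labelledPerm k b π = E i * h.labelledPerm k (Function.update b i 1) π := by
  have hb : b = Pi.mulSingle i (b i) * Function.update b i 1 := by
    funext j
    by_cases hj : j = i
    · subst hj; simp
    · simp [hj]
  nth_rw 1 [hb]
  rw [← h.label_mul_labelledPerm, ← mul_assoc, h.label_base, h.label_self, ← h.comm, mul_assoc,
    h.idem_mul_labelledPerm]

theorem idem_mul_labelledPerm_swap {i j : Fin n} (hij : i ≠ j) (k : Fin n) (b : Fin n → M)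
    (π : Perm (Fin n)) :
    E i * (E j * h.labelledPerm k b (π * swap i j)) = E i * (E j * h.labelledPerm k b π) := by
  -- Once the labels at the holes `i` and `j` are erased, swapping these coordinates changes
  -- nothing.
  have hu : Function.update (Function.update b j 1) i 1 =
      Function.update (Function.update (b ∘ swap i j) j 1) i 1 := by
    funext l
    simp only [Function.update_apply, Function.comp, swap_apply_def]
    grind
  have hb : ∀ c : Fin n → M, E i * (E j * h.labelledPerm k c π) =
      E i * (E j * h.labelledPerm k (Function.update (Function.update c j 1) i 1) π) := by
    intro c
    rw [h.idem_mul_labelledPerm_update j, h.comm_assoc, h.idem_mul_labelledPerm_update i,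
      h.comm_assoc]
  rw [hb b, hu, ← hb, h.labelledPerm_mul_swap, ← mul_assoc (E j), ← mul_assoc (E i),
    h.idem_mul_idem_mul_holeSwap hij, mul_assoc, mul_assoc, h.labelledPerm_base]
  by_cases hi : k = i
  · rw [hi, swap_apply_left, h.idem_assoc]
  by_cases hj : k = j
  · rw [hj, swap_apply_right, h.comm_assoc, h.idem_assoc, h.comm_assoc]
  rw [swap_apply_of_ne_of_ne hi hj, h.idem_mul_labelledPerm]

theorem holes_labelledPerm_tuple {L : List (Fin n)} (k : Fin n) {b c : Fin n → M}
    (hbc : ∀ i, i ∉ L → b i = c i) (π : Perm (Fin n)) :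
    holes E L (h.labelledPerm k b π) = holes E L (h.labelledPerm k c π) := by
  have key : ∀ (b : Fin n → M) (s : Finset (Fin n)), (∀ i ∈ s, i ∈ L) →
      holes E L (h.labelledPerm k b π) = holes E L (h.labelledPerm k (s.piecewise 1 b) π) := by
    intro b s
    induction s using Finset.induction_on with
    | empty => simp
    | insert i s hi ih =>
      intro hs
      have hiL := hs i (Finset.mem_insert_self i s)
      rw [ih fun j hj => hs j (Finset.mem_insert_of_mem hj), Finset.piecewise_insert,
        ← h.holes_idem hiL, h.idem_mul_labelledPerm_update, h.holes_idem hiL]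
      rfl
  rw [key b L.toFinset (by simp), key c L.toFinset (by simp)]
  congr 2
  funext i
  by_cases hi : i ∈ L
  · simp [Finset.piecewise, hi]
  · simp [Finset.piecewise, hi, hbc i hi]

theorem holes_labelledPerm_perm {L : List (Fin n)} (k : Fin n) (b : Fin n → M)
    {π ρ : Perm (Fin n)} (hπ : ∀ i, i ∉ L → π i = ρ i) :
    holes E L (h.labelledPerm k b π) = holes E L (h.labelledPerm k b ρ) := by
  -- A permutation of the holes is a product of transpositions of holes, each of which is absorbed;
  -- `π⁻¹ * ρ` is such a permutation.
  have key : ∀ τ : Perm {i // i ∈ L}, holes E L (h.labelledPerm k b (π * Perm.ofSubtype τ)) =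
      holes E L (h.labelledPerm k b π) := by
    intro τ
    induction τ using Perm.swap_induction_on' with
    | one => rw [map_one, mul_one]
    | mul_swap τ i j hij ih =>
      rw [← ih, map_mul, Perm.ofSubtype_swap_eq, ← mul_assoc, ← h.holes_idem i.2,
        ← h.holes_idem i.2 (h.labelledPerm _ _ _), ← h.idem_mul_holes, ← h.idem_mul_holes,
        ← h.holes_idem j.2, ← h.holes_idem j.2 (h.labelledPerm _ _ _), h.idem_mul_holes,
        h.idem_mul_holes, h.idem_mul_labelledPerm_swap (Subtype.coe_ne_coe.mpr hij)]
  have hfix : ∀ i, i ∉ L → (π⁻¹ * ρ) i = i := fun i hi => by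
    rw [Perm.mul_apply, ← hπ i hi, Perm.inv_def, symm_apply_apply]
  have hmem : ∀ i, i ∈ L ↔ (π⁻¹ * ρ) i ∈ L := by
    intro i
    by_cases hi : i ∈ L
    · refine iff_of_true hi ?_
      by_contra hiL
      rw [(π⁻¹ * ρ).injective (hfix _ hiL)] at hiL
      exact hiL hi
    · rw [hfix i hi]
  have hτ : π * Perm.ofSubtype ((π⁻¹ * ρ).subtypePerm (p := (· ∈ L)) fun i => (hmem i).symm) =
      ρ := by
    rw [Perm.ofSubtype_subtypePerm, mul_inv_cancel_left]
    intro i hi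
    by_contra hiL
    exact hi (hfix i hiL)
  rw [← key, hτ]

/-- Two normal forms are equal if they agree away from the holes. -/
theorem holes_labelledPerm_congr {L L' : List (Fin n)} {k k' : Fin n} {b b' : Fin n → M}
    {π π' : Perm (Fin n)} (hk : k ∈ L) (hk' : k' ∈ L') (hL : ∀ i, i ∈ L ↔ i ∈ L')
    (hb : ∀ i, i ∉ L → b i = b' i) (hπ : ∀ i, i ∉ L → π i = π' i) :
    holes E L (h.labelledPerm k b π) = holes E L' (h.labelledPerm k' b' π') := by
  rw [h.holes_labelledPerm_tuple k hb, h.holes_labelledPerm_perm k b' hπ,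
    ← h.holes_idem ((hL k').mpr hk'), h.labelledPerm_base, h.holes_idem hk, h.holes_congr hL]

/-- A move of a hole, applied to a normal form. -/
theorem move_mul_holes {i j : Fin n} (hij : i ≠ j) {L : List (Fin n)} {k : Fin n} (hk : k ∈ L)
    (b : Fin n → M) (π : Perm (Fin n)) :
    F i j * holes E L (h.labelledPerm k b π) = holes E (i :: L.map (swap i j))
      (h.labelledPerm (swap i j k) (b ∘ swap i j) (π * swap i j)) := by
  -- Worked from the right-hand side: the new hole at `i` turns the transposition at `swap i j k`
  -- into the move `F i j`, and the leftover idempotent becomes `E k`, which `L` absorbs.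
  rw [holes_cons, ← h.holeSwap_mul_labelledPerm, swap_apply_self,
    ← mul_holes fun l => by rw [h.idem_mul_holeSwap, swap_apply_self], ← mul_assoc,
    h.idem_mul_holeSwap_base, holeSwap_left E F hij, h.idem_mul_move hij, swap_apply_self,
    mul_assoc, h.idem_mul_holes_of_mem hk]

/-- A label, applied to a normal form. -/
theorem label_mul_holes (j i : Fin n) (a : M) {L : List (Fin n)} {k : Fin n} (hk : k ∈ L)
    (b : Fin n → M) (π : Perm (Fin n)) :
    D j i a * holes E L (h.labelledPerm k b π) =
      holes E (j :: L) (h.labelledPerm k (Pi.mulSingle i a * b) π) := by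
  have hm := mul_holes (g := id) (fun l => (h.idem_mul_label l k i a).symm) L
    (h.labelledPerm k b π)
  rw [List.map_id] at hm
  rw [holes_cons, ← h.label_mul_labelledPerm, ← hm, ← mul_assoc, h.label_base, h.idem_mul_label,
    mul_assoc, h.idem_mul_holes_of_mem hk]

end HoleLabels

/-! ### Normal forms in the wreath product, and soundness of the relations. -/

section WreathOf

variable {M : Type*} {n : ℕ}

theorem one_symm_apply (i : Fin n) : (1 : Perm (Fin n)).symm i = i := rfl

/-- The element of the wreath product obtained from the permutation `π` with labels `b` by
removing the points in the list `L` from the domain. -/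
def wreathOf (L : List (Fin n)) (b : Fin n → M) (π : Perm (Fin n)) : Wreath M n where
  tuple i := if i ∈ L then 0 else (b i : WithZero M)
  map :=
    { toFun := fun i => if i ∈ L then none else some (π i)
      invFun := fun j => if π.symm j ∈ L then none else some (π.symm j)
      inv := by
        intro i j
        have : π.symm j = i ↔ π i = j := by rw [symm_apply_eq, eq_comm]
        grind }
  supp_tuple := by
    ext i
    by_cases hi : i ∈ L <;> simp [supp, dom, hi]

theorem wreathOf_tuple (L : List (Fin n)) (b : Fin n → M) (π : Perm (Fin n)) (i : Fin n) :
    (wreathOf L b π).tuple i = if i ∈ L then 0 else (b i : WithZero M) := rfl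

theorem wreathOf_map (L : List (Fin n)) (b : Fin n → M) (π : Perm (Fin n)) (i : Fin n) :
    (wreathOf L b π).map i = if i ∈ L then none else some (π i) := rfl

theorem wreathOf_eq_iff {L L' : List (Fin n)} {b b' : Fin n → M} {π π' : Perm (Fin n)} :
    wreathOf L b π = wreathOf L' b' π' ↔
      ∀ i, (i ∈ L ↔ i ∈ L') ∧ (i ∉ L → b i = b' i) ∧ (i ∉ L → π i = π' i) := by
  constructor
  · intro hw i
    have h1 := congrArg (fun w : Wreath M n => w.tuple i) hw
    have h2 := congrArg (fun w : Wreath M n => w.map i) hw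
    simp only [wreathOf_tuple, wreathOf_map] at h1 h2
    by_cases hi : i ∈ L <;> by_cases hi' : i ∈ L' <;> simp_all
  · intro hw
    ext i : 2
    · rw [wreathOf_tuple, wreathOf_tuple]
      by_cases hi : i ∈ L
      · rw [if_pos hi, if_pos ((hw i).1.mp hi)]
      · rw [if_neg hi, if_neg (mt (hw i).1.mpr hi), (hw i).2.1 hi]
    · rw [wreathOf_map, wreathOf_map]
      by_cases hi : i ∈ L
      · rw [if_pos hi, if_pos ((hw i).1.mp hi)]
      · rw [if_neg hi, if_neg (mt (hw i).1.mpr hi), (hw i).2.2 hi]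

theorem ofTuple_eq_wreathOf {a : Fin n → WithZero M} {L : List (Fin n)} {b : Fin n → M}
    (ha : ∀ i, a i = if i ∈ L then 0 else (b i : WithZero M)) :
    ofTuple a = wreathOf L b 1 := by
  have hs : ∀ i, i ∈ supp a ↔ i ∉ L := by
    intro i
    by_cases hi : i ∈ L <;> simp [supp, ha, hi]
  ext i : 2
  · exact ha i
  · classical
    have hm : (ofTuple a).map i = PEquiv.ofSet (supp a) i := by
      simp only [ofTuple]
    rw [hm]
    rw [wreathOf_map]
    by_cases hi : i ∈ L
    · rw [if_pos hi]
      exact Option.eq_none_iff_forall_ne_some.mpr fun j hj =>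
        (hs j).mp (PEquiv.ofSet_eq_some_iff.mp hj).2 ((PEquiv.ofSet_eq_some_iff.mp hj).1 ▸ hi)
    · rw [if_neg hi, PEquiv.ofSet_eq_some_self_iff.mpr ((hs i).mpr hi)]
      rfl

variable [Monoid M]

/-- A point is deleted if it is a hole of the first factor or is sent to a hole of the second; the
permutations appear in reverse order. -/
theorem wreathOf_mul (L L' : List (Fin n)) (b b' : Fin n → M) (π π' : Perm (Fin n)) :
    wreathOf L b π * wreathOf L' b' π' =
      wreathOf (L ++ L'.map π.symm) (b * b' ∘ π) (π' * π) := by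
  have hmem : ∀ i, i ∈ L'.map π.symm ↔ π i ∈ L' := fun i => by
    simp [List.mem_map, symm_apply_eq]
  ext i : 2
  · rw [Wreath.tuple_mul, Pi.mul_apply, act, wreathOf_map, wreathOf_tuple, wreathOf_tuple]
    simp only [List.mem_append, hmem]
    by_cases hi : i ∈ L
    · simp [hi]
    · by_cases hi' : π i ∈ L' <;> simp [hi, hi', wreathOf_tuple]
  · rw [Wreath.map_mul, SymInv.mul_def, PEquiv.trans]
    change ((wreathOf L b π).map i).bind (wreathOf L' b' π').map = _
    rw [wreathOf_map, wreathOf_map]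
    simp only [List.mem_append, hmem]
    by_cases hi : i ∈ L
    · simp [hi]
    · by_cases hi' : π i ∈ L' <;> simp [hi, hi', wreathOf_map]

theorem ofMap_fBar (i j : Fin n) :
    (ofMap (fBar i j) : Wreath M n) = wreathOf [i] 1 (swap i j) := by
  have hf : ∀ k, fBar i j k = if k = i then none else if k = j then some i else some k :=
    fun k => rfl
  ext k : 2
  · simp only [ofMap, act, wreathOf_tuple, hf]
    by_cases hi : k = i
    · simp [hi]
    · by_cases hj : k = j
      · simp only [hj, List.mem_singleton, if_neg (hj ▸ hi : ¬j = i), if_true]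
        rfl
      · simp [hi, hj]
  · simp only [ofMap, wreathOf_map, hf, swap_apply_def, List.mem_singleton]
    grind

theorem ofTuple_eBar (i : Fin n) : ofTuple (eBar M i) = wreathOf [i] 1 1 :=
  ofTuple_eq_wreathOf fun k => by simp [eBar]

theorem ofTuple_xBar (a : M) {i j : Fin n} (hij : i ≠ j) :
    ofTuple (xBar a i j) = wreathOf [j] (Pi.mulSingle i a) 1 :=
  ofTuple_eq_wreathOf fun k => by
    by_cases hi : k = i
    · subst hi; simp [xBar, hij]
    · by_cases hj : k = j <;> simp [xBar, hi, hj]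
      rintro rfl
      exact absurd hj hi

section Images

variable {X : Type*} (φ : FreeMonoid X →* M)

theorem phiMS_mul (u v : FreeSemigroup (Gen X n)) :
    (phiMS φ n (u * v)).1 = (phiMS φ n u).1 * (phiMS φ n v).1 := by
  rw [map_mul]
  rfl

theorem phiMS_f (i j : Fin n) (hij : i ≠ j) :
    (phiMS φ n (f i j hij)).1 = wreathOf [i] 1 (swap i j) := by
  rw [phiMS, f, FreeSemigroup.lift_of]
  exact ofMap_fBar i j

theorem phiMS_e (i : Fin n) : (phiMS φ n (e i)).1 = wreathOf [i] 1 1 := by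
  rw [phiMS, e, FreeSemigroup.lift_of]
  exact ofTuple_eBar i

theorem phiMS_x (a : X) (i j : Fin n) (hij : i ≠ j) :
    (phiMS φ n (x a i j hij)).1 = wreathOf [j] (Pi.mulSingle i (φ (.of a))) 1 := by
  rw [phiMS, x, FreeSemigroup.lift_of]
  exact ofTuple_xBar _ hij

/-- The second factor must be nonempty: for an empty tail the product would end in `e_j`, and the
two words would only be congruent. -/
theorem word_of_mul (a b : X) (w : FreeMonoid X) (i j : Fin n) (hij : i ≠ j) :
    word (.of a * (.of b * w)) i j hij = x a i j hij * word (.of b * w) i j hij := rfl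

theorem phiMS_word (w : FreeMonoid X) (i j : Fin n) (hij : i ≠ j) :
    (phiMS φ n (word w i j hij)).1 = wreathOf [j] (Pi.mulSingle i (φ w)) 1 := by
  induction w using FreeMonoid.inductionOn' with
  | one => rw [map_one, Pi.mulSingle_one]; exact phiMS_e φ j
  | of_mul a w ih =>
    cases w using FreeMonoid.inductionOn' with
    | one => rw [mul_one]; exact phiMS_x φ a i j hij
    | of_mul b w =>
      rw [word_of_mul, map_mul φ, phiMS_mul, ih, phiMS_x, wreathOf_mul, wreathOf_eq_iff]
      intro k
      simp [Pi.mulSingle_mul, one_symm_apply]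

theorem relMS_le_ker {R : FreeMonoid X → FreeMonoid X → Prop}
    (hφ : ∀ u v, R u v → φ u = φ v) {u v : FreeSemigroup (Gen X n)} (h : RelMS R n u v) :
    phiMS φ n u = phiMS φ n v := by
  refine Subtype.ext ?_
  rcases h with h | h | h
  · cases h <;>
    simp only [mul_assoc, phiMS_mul, phiMS_f, wreathOf_mul, wreathOf_eq_iff] <;>
    intro k <;> refine ⟨?_, fun hk => ?_, fun hk => ?_⟩ <;>
    simp [swap_apply_def] at * <;> grind
  · cases h with
    | m3 u v huv i j hij => rw [phiMS_word, phiMS_word, hφ u v huv]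
    | _ =>
      simp only [phiMS_mul, phiMS_x, phiMS_e, wreathOf_mul, wreathOf_eq_iff]
      intro k
      refine ⟨?_, fun hk => ?_, fun hk => ?_⟩ <;>
      simp [Pi.mulSingle_apply, one_symm_apply] at * <;> grind
  · cases h <;>
    simp only [phiMS_mul, phiMS_f, phiMS_x, phiMS_e, wreathOf_mul, wreathOf_eq_iff] <;>
    intro k <;> refine ⟨?_, fun hk => ?_, fun hk => ?_⟩ <;>
    simp [swap_apply_def, Pi.mulSingle_apply, one_symm_apply] at * <;> grind

end Images

end WreathOf

/-! ### The presented semigroup satisfies the relations of holes and labels. -/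

section Relations

variable {X : Type*} (R : FreeMonoid X → FreeMonoid X → Prop) (n : ℕ)

/-- The semigroup defined by the presentation. -/
abbrev Presented : Type _ := (conGen (RelMS R n)).Quotient

variable {R n}

theorem presented_eq {u v : FreeSemigroup (Gen X n)} (h : RelMS R n u v) :
    (u : Presented R n) = v :=
  (Con.eq _).mpr (ConGen.Rel.of _ _ h)

variable (R)

/-- The class of `e_i`. -/
def idemClass (i : Fin n) : Presented R n := (e i : FreeSemigroup (Gen X n))

/-- The class of `f_{i,j}`. -/
def moveClass (i j : Fin n) : Presented R n :=
  if h : i ≠ j then (f i j h : FreeSemigroup (Gen X n)) else idemClass R i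

/-- The class of `w^{(i;k)}`. -/
def wordClass (k i : Fin n) (w : FreeMonoid X) : Presented R n :=
  -- The value at `i = k` expresses that a label at the hole is invisible; it is what `label_self`
  -- requires, and it keeps `move_wordClass` uniform in `l`.
  if h : i ≠ k then (word w i k h : FreeSemigroup (Gen X n)) else idemClass R k

theorem moveClass_of_ne {i j : Fin n} (h : i ≠ j) :
    moveClass R i j = (f i j h : FreeSemigroup (Gen X n)) := dif_pos h

theorem wordClass_self (k : Fin n) (w : FreeMonoid X) : wordClass R k k w = idemClass R k :=
  dif_neg (by simp)

theorem wordClass_of_ne {k i : Fin n} (h : i ≠ k) (w : FreeMonoid X) :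
    wordClass R k i w = (word w i k h : FreeSemigroup (Gen X n)) := dif_pos h

theorem wordClass_of {k i : Fin n} (h : i ≠ k) (a : X) :
    wordClass R k i (.of a) = (x a i k h : FreeSemigroup (Gen X n)) := dif_pos h

theorem holeMoves_presented : HoleMoves (idemClass R (n := n)) (moveClass R) where
  idem i := presented_eq (.inr (.inl (.m1 i)))
  comm i j := presented_eq (.inr (.inl (.m2 i j)))
  move_back i j hij := by
    rw [moveClass_of_ne R hij, moveClass_of_ne R hij.symm]
    exact presented_eq (.inr (.inr (.ms1 i j hij)))
  source i j hij := by
    have h1 : (f i j hij * f j i hij.symm : FreeSemigroup (Gen X n)) = idemClass R i :=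
      presented_eq (R := R) (.inr (.inr (.ms1 i j hij)))
    rw [moveClass_of_ne R hij, ← h1]
    exact presented_eq (.inl (.s1 i j hij))
  cube i j hij := by
    rw [moveClass_of_ne R hij]
    exact presented_eq (.inl (.s2a i j hij))
  sq i j hij := by
    rw [moveClass_of_ne R hij, moveClass_of_ne R hij.symm]
    exact presented_eq (.inl (.s2b i j hij))
  slide i j k hij hik hjk := by
    rw [moveClass_of_ne R hij, moveClass_of_ne R hik, moveClass_of_ne R hjk]
    exact presented_eq (.inl (.s5a i j k hij hik hjk))
  triangle i j k hij hik hjk := by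
    rw [moveClass_of_ne R hij, moveClass_of_ne R hik, moveClass_of_ne R hjk,
      moveClass_of_ne R hij.symm, moveClass_of_ne R hik.symm, moveClass_of_ne R hjk.symm]
    exact presented_eq (.inl (.s6 i j k hij hik hjk))
  transport i j k l hij hik hil hjk hjl hkl := by
    rw [moveClass_of_ne R hij, moveClass_of_ne R hjk, moveClass_of_ne R hjl,
      moveClass_of_ne R hkl, moveClass_of_ne R hik.symm, moveClass_of_ne R hil.symm]
    exact presented_eq (.inl (.s7 i j k l hij hik hil hjk hjl hkl))

theorem wordClass_one (k i : Fin n) : wordClass R k i 1 = idemClass R k := by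
  by_cases hik : i = k
  · rw [hik, wordClass_self]
  · rw [wordClass_of_ne R hik]
    rfl

theorem idemClass_comm_letter (j k i : Fin n) (a : X) :
    idemClass R j * wordClass R k i (.of a) = wordClass R k i (.of a) * idemClass R j := by
  by_cases hik : i = k
  · rw [hik, wordClass_self, (holeMoves_presented R).comm]
  rw [wordClass_of R hik]
  by_cases hj : j = k
  · subst hj
    exact (presented_eq (.inr (.inl (.m5a a i j hik)))).symm
  by_cases hi : j = i
  · subst hi
    exact (presented_eq (.inr (.inl (.m6a a j k hik)))).symm
  · exact (presented_eq (.inr (.inl (.m4a a i k j hik hi hj)))).symm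

theorem idemClass_mul_letter (k i : Fin n) (a : X) :
    idemClass R k * wordClass R k i (.of a) = wordClass R k i (.of a) := by
  by_cases hik : i = k
  · rw [hik, wordClass_self, (holeMoves_presented R).idem]
  · rw [wordClass_of R hik]
    exact presented_eq (.inr (.inl (.m5b a i k hik)))

/-- For distinct indices this is `m4b`; when `i` is one of the holes, `m6b` reduces both sides to
idempotents. -/
theorem letter_base (j k i : Fin n) (a : X) :
    idemClass R j * wordClass R k i (.of a) = idemClass R k * wordClass R j i (.of a) := by
  have key : ∀ {i k : Fin n}, i ≠ k → idemClass R i * wordClass R k i (.of a) =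
      idemClass R i * idemClass R k := fun {i k} hik => by
    rw [wordClass_of R hik]
    exact presented_eq (.inr (.inl (.m6b a i k hik)))
  by_cases hjk : j = k
  · rw [hjk]
  by_cases hik : i = k
  · subst hik
    rw [wordClass_self, key (Ne.symm hjk), (holeMoves_presented R).comm]
  by_cases hij : i = j
  · subst hij
    rw [wordClass_self, key hik, (holeMoves_presented R).comm]
  rw [wordClass_of R hik, wordClass_of R hij]
  exact presented_eq (.inr (.inl (.m4b a i k j hik (Ne.symm hij) hjk)))

theorem letter_comm (k : Fin n) {i j : Fin n} (hij : i ≠ j) (a b : X) :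
    Commute (wordClass R k i (.of a)) (wordClass R k j (.of b)) := by
  by_cases hik : i = k
  · rw [hik, wordClass_self]
    exact idemClass_comm_letter R k k j b
  by_cases hjk : j = k
  · rw [hjk, wordClass_self]
    exact (idemClass_comm_letter R k k i a).symm
  rw [wordClass_of R hik, wordClass_of R hjk]
  exact presented_eq (.inr (.inl (.m7 a b i j k hij hik hjk)))

theorem move_letter {i j : Fin n} (hij : i ≠ j) (l : Fin n) (a : X) :
    moveClass R i j * wordClass R j l (.of a) =
      wordClass R i (swap i j l) (.of a) * moveClass R i j := by
  have h := holeMoves_presented R (n := n)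
  by_cases hj : l = j
  · rw [hj, swap_apply_right, wordClass_self, wordClass_self, h.target hij, h.source i j hij]
  by_cases hi : l = i
  · rw [hi, swap_apply_left, wordClass_of R hij, wordClass_of R hij.symm, moveClass_of_ne R hij]
    exact presented_eq (.inr (.inr (.ms2 a i j hij)))
  · rw [swap_apply_of_ne_of_ne hi hj, wordClass_of R hi, wordClass_of R hj,
      moveClass_of_ne R hij]
    exact presented_eq (.inr (.inr (.ms4' a i j l hij hi hj)))

theorem wordClass_of_mul (k i : Fin n) (a : X) (w : FreeMonoid X) :
    wordClass R k i (.of a * w) = wordClass R k i (.of a) * wordClass R k i w := by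
  cases w using FreeMonoid.inductionOn' with
  | one =>
    rw [mul_one, wordClass_one, ← idemClass_comm_letter, idemClass_mul_letter]
  | of_mul b w =>
    by_cases hik : i = k
    · rw [hik, wordClass_self, wordClass_self, wordClass_self, (holeMoves_presented R).idem]
    · rw [wordClass_of_ne R hik, wordClass_of R hik, wordClass_of_ne R hik, word_of_mul]
      rfl

theorem idemClass_mul_wordClass (k i : Fin n) (w : FreeMonoid X) :
    idemClass R k * wordClass R k i w = wordClass R k i w := by
  cases w using FreeMonoid.inductionOn' with
  | one => rw [wordClass_one, (holeMoves_presented R).idem]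
  | of_mul a w => rw [wordClass_of_mul, ← mul_assoc, idemClass_mul_letter]

theorem wordClass_mul (k i : Fin n) (u w : FreeMonoid X) :
    wordClass R k i (u * w) = wordClass R k i u * wordClass R k i w := by
  induction u using FreeMonoid.inductionOn' with
  | one => rw [one_mul, wordClass_one, idemClass_mul_wordClass]
  | of_mul a u ih => rw [mul_assoc, wordClass_of_mul, ih, wordClass_of_mul, mul_assoc]

theorem idemClass_comm_wordClass (j k i : Fin n) (w : FreeMonoid X) :
    idemClass R j * wordClass R k i w = wordClass R k i w * idemClass R j := by
  induction w using FreeMonoid.inductionOn' with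
  | one => rw [wordClass_one, (holeMoves_presented R).comm]
  | of_mul a w ih =>
    rw [wordClass_of_mul, ← mul_assoc, idemClass_comm_letter, mul_assoc, ih, mul_assoc]

theorem wordClass_base (j k i : Fin n) (w : FreeMonoid X) :
    idemClass R j * wordClass R k i w = idemClass R k * wordClass R j i w := by
  have h := holeMoves_presented R (n := n)
  induction w using FreeMonoid.inductionOn' with
  | one => rw [wordClass_one, wordClass_one, h.comm]
  | of_mul a w ih =>
    rw [wordClass_of_mul, wordClass_of_mul, ← mul_assoc, idemClass_comm_letter, mul_assoc, ih,
      ← mul_assoc, ← idemClass_comm_letter, mul_assoc, ← idemClass_mul_wordClass R j,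
      ← mul_assoc (wordClass R k i _), ← idemClass_comm_letter, letter_base, mul_assoc,
      h.idem_assoc, idemClass_mul_wordClass]

theorem wordClass_comm (k : Fin n) {i j : Fin n} (hij : i ≠ j) (u w : FreeMonoid X) :
    Commute (wordClass R k i u) (wordClass R k j w) := by
  have key : ∀ a, Commute (wordClass R k i (.of a)) (wordClass R k j w) := by
    intro a
    induction w using FreeMonoid.inductionOn' with
    | one =>
      rw [wordClass_one]
      exact (idemClass_comm_wordClass R k k i _).symm
    | of_mul b w ih =>
      rw [wordClass_of_mul]
      exact (letter_comm R k hij a b).mul_right ih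
  induction u using FreeMonoid.inductionOn' with
  | one =>
    rw [wordClass_one]
    exact idemClass_comm_wordClass R k k j w
  | of_mul a u ih =>
    rw [wordClass_of_mul]
    exact (key a).mul_left ih

theorem move_wordClass {i j : Fin n} (hij : i ≠ j) (l : Fin n) (w : FreeMonoid X) :
    moveClass R i j * wordClass R j l w = wordClass R i (swap i j l) w * moveClass R i j := by
  have h := holeMoves_presented R (n := n)
  induction w using FreeMonoid.inductionOn' with
  | one => rw [wordClass_one, wordClass_one, h.target hij, h.source i j hij]
  | of_mul a w ih =>
    rw [wordClass_of_mul, ← mul_assoc, move_letter R hij, mul_assoc, ih, wordClass_of_mul,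
      mul_assoc]

variable {R} {M : Type*} [Monoid M] {φ : FreeMonoid X →* M}

/-- The map `wordClass R k i` is multiplicative and respects `R`, so its kernel contains the
congruence generated by `R`, which is the kernel of `φ`. -/
theorem wordClass_congr (hφ : IsMonoidPresentation R φ) {u v : FreeMonoid X} (huv : φ u = φ v)
    (k i : Fin n) : wordClass R k i u = wordClass R k i v := by
  let g : FreeMonoid X →ₙ* Presented R n := ⟨wordClass R k i, wordClass_mul R k i⟩
  have hle : Con.ker φ ≤ Con.ker g := by
    rw [hφ.2]
    refine Con.conGen_le.mpr fun u v h => ?_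
    change wordClass R k i u = wordClass R k i v
    by_cases hik : i = k
    · rw [hik, wordClass_self, wordClass_self]
    · rw [wordClass_of_ne R hik, wordClass_of_ne R hik]
      exact presented_eq (.inr (.inl (.m3 u v h i k hik)))
  exact hle huv

/-- The class of `w^{(i;k)}`, for any word `w` that represents `a`. -/
noncomputable def labelClass (hφ : IsMonoidPresentation R φ) (k i : Fin n) (a : M) :
    Presented R n :=
  wordClass R k i (Function.surjInv hφ.1 a)

theorem labelClass_apply (hφ : IsMonoidPresentation R φ) (k i : Fin n) (w : FreeMonoid X) :
    labelClass hφ k i (φ w) = wordClass R k i w :=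
  wordClass_congr hφ (Function.surjInv_eq hφ.1 (φ w)) k i

theorem holeLabels_presented (hφ : IsMonoidPresentation R φ) :
    HoleLabels (idemClass R (n := n)) (moveClass R) (labelClass hφ) where
  toHoleMoves := holeMoves_presented R
  label_one k i := by rw [← map_one φ, labelClass_apply, wordClass_one]
  label_mul k i a b := by
    obtain ⟨u, rfl⟩ := hφ.1 a
    obtain ⟨v, rfl⟩ := hφ.1 b
    rw [← map_mul, labelClass_apply, labelClass_apply, labelClass_apply, wordClass_mul]
  label_self k a := wordClass_self R k _
  label_comm k i j a b hij := wordClass_comm R k hij _ _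
  label_base j k i a := wordClass_base R j k i _
  idem_mul_label j k i a := idemClass_comm_wordClass R j k i _
  move_mul_label i j l a hij := move_wordClass R hij l _

end Relations

/-! ### Existence of normal forms, and injectivity on the presented semigroup. -/

section NormalForm

variable {X M : Type*} [Monoid M] {R : FreeMonoid X → FreeMonoid X → Prop}
  {φ : FreeMonoid X →* M} {n : ℕ}

/-- The word `w` has a normal form that also describes its image in the wreath product. -/
def HasNormalForm (hφ : IsMonoidPresentation R φ) (w : FreeSemigroup (Gen X n)) : Prop :=
  ∃ L k b π, k ∈ L ∧
    (w : Presented R n) =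
      holes (idemClass R) L ((holeLabels_presented hφ).labelledPerm k b π) ∧
    (phiMS φ n w).1 = wreathOf L b π

variable (hφ : IsMonoidPresentation R φ)
include hφ

theorem phiMS_eq_of_presented_eq {u v : FreeSemigroup (Gen X n)}
    (h : (u : Presented R n) = v) : phiMS φ n u = phiMS φ n v := by
  have hR : ∀ u v, R u v → φ u = φ v := fun u v huv => by
    have : Con.ker φ u v := by
      rw [hφ.2]
      exact ConGen.Rel.of _ _ huv
    exact this
  have hle : conGen (RelMS R n) ≤ Con.ker (phiMS φ n) :=
    Con.conGen_le.mpr fun u v huv => relMS_le_ker φ hR huv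
  exact hle ((Con.eq _).mp h)

theorem HasNormalForm.congr {u v : FreeSemigroup (Gen X n)} (h : (u : Presented R n) = v)
    (hu : HasNormalForm hφ u) : HasNormalForm hφ v := by
  obtain ⟨L, k, b, π, hk, h1, h2⟩ := hu
  exact ⟨L, k, b, π, hk, h ▸ h1, phiMS_eq_of_presented_eq hφ h ▸ h2⟩

theorem hasNormalForm_e (k : Fin n) : HasNormalForm hφ (e k) := by
  refine ⟨[k], k, 1, 1, by simp, ?_, phiMS_e φ k⟩
  rw [holes_cons, HoleLabels.labelledPerm_one]
  exact ((holeMoves_presented R).idem k).symm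

theorem HasNormalForm.mul_left (g : Gen X n) {w : FreeSemigroup (Gen X n)}
    (hw : HasNormalForm hφ w) : HasNormalForm hφ (.of g * w) := by
  obtain ⟨L, k, b, π, hk, h1, h2⟩ := hw
  have h := holeLabels_presented hφ (n := n)
  cases g with
  | f i j hij =>
    refine ⟨i :: L.map (swap i j), swap i j k, b ∘ swap i j, π * swap i j,
      List.mem_cons_of_mem _ (List.mem_map_of_mem hk), ?_, ?_⟩
    · rw [← h.move_mul_holes hij hk, ← h1, moveClass_of_ne R hij]
      rfl
    · refine (phiMS_mul φ (f i j hij) w).trans ?_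
      rw [phiMS_f, h2, wreathOf_mul, symm_swap, one_mul]
      rfl
  | e i =>
    refine ⟨i :: L, k, b, π, List.mem_cons_of_mem _ hk, ?_, ?_⟩
    · rw [holes_cons, ← h1]
      rfl
    · refine (phiMS_mul φ (e i) w).trans ?_
      rw [phiMS_e, h2, wreathOf_mul, one_mul, mul_one]
      exact congrArg (fun L => wreathOf (i :: L) b π) (List.map_id L)
  | x a i j hij =>
    refine ⟨j :: L, k, Pi.mulSingle i (φ (.of a)) * b, π, List.mem_cons_of_mem _ hk, ?_, ?_⟩
    · rw [← h.label_mul_holes j i _ hk, ← h1, labelClass_apply, wordClass_of R hij]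
      rfl
    · refine (phiMS_mul φ (x a i j hij) w).trans ?_
      rw [phiMS_x, h2, wreathOf_mul, mul_one]
      exact congrArg (fun L => wreathOf (j :: L) _ π) (List.map_id L)

theorem hasNormalForm (w : FreeSemigroup (Gen X n)) : HasNormalForm hφ w := by
  have h := holeMoves_presented R (n := n)
  induction w using FreeSemigroup.recOnMul with
  | ih1 g =>
    cases g with
    | f i j hij =>
      -- A single letter is congruent to itself followed by `e_j`, so the induction on words can
      -- start from an idempotent.
      refine (HasNormalForm.mul_left hφ (.f i j hij) (hasNormalForm_e hφ j)).congr hφ ?_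
      have := h.target hij
      rw [moveClass_of_ne R hij] at this
      exact this
    | e i => exact hasNormalForm_e hφ i
    | x a i j hij =>
      refine (HasNormalForm.mul_left hφ (.x a i j hij) (hasNormalForm_e hφ j)).congr hφ ?_
      have := idemClass_mul_letter R j i a
      rw [idemClass_comm_letter, wordClass_of R hij] at this
      exact this
  | ih2 g w _ hw => exact hw.mul_left hφ g

theorem presented_eq_of_phiMS_eq {u v : FreeSemigroup (Gen X n)}
    (h : phiMS φ n u = phiMS φ n v) : (u : Presented R n) = v := by
  obtain ⟨L, k, b, π, hk, h1, h2⟩ := hasNormalForm hφ u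
  obtain ⟨L', k', b', π', hk', h1', h2'⟩ := hasNormalForm hφ v
  rw [h, h2'] at h2
  have key := wreathOf_eq_iff.mp h2.symm
  rw [h1, h1']
  exact (holeLabels_presented hφ).holes_labelledPerm_congr hk hk' (fun i => (key i).1)
    (fun i => (key i).2.1) (fun i => (key i).2.2)

end NormalForm

/-! ### Surjectivity onto the singular wreath product. -/

section Surjective

variable {X M : Type*} [Monoid M] {φ : FreeMonoid X →* M} {n : ℕ}

/-- The images of words in the wreath product. -/
def IsWordImage (φ : FreeMonoid X →* M) (z : Wreath M n) : Prop :=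
  ∃ w, (phiMS φ n w).1 = z

theorem IsWordImage.mul {z z' : Wreath M n} (hz : IsWordImage φ z) (hz' : IsWordImage φ z') :
    IsWordImage φ (z * z') := by
  obtain ⟨w, rfl⟩ := hz
  obtain ⟨w', rfl⟩ := hz'
  exact ⟨w * w', phiMS_mul φ w w'⟩

theorem isWordImage_swap (k : Fin n) {i j : Fin n} (hij : i ≠ j) :
    IsWordImage φ (wreathOf [k] 1 (swap i j)) := by
  have hf : ∀ {i j : Fin n}, i ≠ j → IsWordImage φ (wreathOf [i] 1 (swap i j)) :=
    fun hij => ⟨f _ _ hij, phiMS_f φ _ _ hij⟩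
  by_cases hi : k = i
  · rw [hi]
    exact hf hij
  by_cases hj : k = j
  · rw [hj, swap_comm]
    exact hf (Ne.symm hij)
  -- The trip `k, i, j, k` of the hole, as in `holeSwap`.
  convert (hf hi).mul ((hf hij).mul (hf (Ne.symm hj))) using 1
  rw [wreathOf_mul, wreathOf_mul, wreathOf_eq_iff]
  intro l
  refine ⟨?_, fun hl => ?_, fun hl => ?_⟩ <;>
  simp [swap_apply_def] at * <;> grind

theorem isWordImage_label (hφ : Function.Surjective φ) (k i : Fin n) (a : M) :
    IsWordImage φ (wreathOf [k] (Pi.mulSingle i a) 1) := by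
  by_cases hik : i = k
  -- A label at the hole does not show.
  · refine ⟨e k, ?_⟩
    rw [phiMS_e, wreathOf_eq_iff]
    intro l
    simp [hik, Pi.mulSingle_apply]
    intro h1 h2
    exact absurd h2 h1
  · obtain ⟨w, rfl⟩ := hφ a
    exact ⟨word w i k hik, phiMS_word φ w i k hik⟩

theorem isWordImage_wreathOf (hφ : Function.Surjective φ) {L : List (Fin n)} (hL : L ≠ [])
    (b : Fin n → M) (π : Perm (Fin n)) : IsWordImage φ (wreathOf L b π) := by
  have main : ∀ k, IsWordImage φ (wreathOf [k] b π) := by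
    induction π using Perm.swap_induction_on' generalizing b with
    | one =>
      intro k
      induction b using tuple_induction with
      | one => exact ⟨e k, phiMS_e φ k⟩
      | mul i a b ih =>
        convert (isWordImage_label hφ k i a).mul ih using 1
        rw [wreathOf_mul, wreathOf_eq_iff]
        intro l
        simp [one_symm_apply]
    | mul_swap π i j hij ih =>
      intro k
      convert (isWordImage_swap k hij).mul (ih (b ∘ swap i j) (swap i j k)) using 1
      rw [wreathOf_mul, wreathOf_eq_iff]
      intro l
      simp
  induction L with
  | nil => exact absurd rfl hL
  | cons k L ih =>
    cases L with
    | nil => exact main k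
    | cons j L =>
      convert IsWordImage.mul ⟨e k, phiMS_e φ k⟩ (ih (by simp)) using 1
      rw [wreathOf_mul, wreathOf_eq_iff]
      intro l
      simp [one_symm_apply]

theorem exists_wreathOf {z : Wreath M n} (hz : z ∈ wreathOver M (singSymInv n)) :
    ∃ (L : List (Fin n)) (b : Fin n → M) (π : Perm (Fin n)), L ≠ [] ∧ z = wreathOf L b π := by
  classical
  let s : Finset (Fin n) := Finset.univ.filter fun i => (z.map i).isSome
  have hs : ∀ i, i ∈ s ↔ i ∈ dom z.map := fun i => by simp [s, dom]
  have hsupp : ∀ i, i ∈ s ↔ z.tuple i ≠ 0 := fun i => by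
    rw [hs, ← z.supp_tuple]
    rfl
  -- A partial bijection of a finite set extends from its domain to a permutation. The holes are the
  -- points outside the domain, and labels there are set to `1`.
  obtain ⟨g, hg⟩ := Finset.exists_equiv_extend_of_card_eq (t := Finset.univ) (s := s)
    (f := fun i => (z.map i).getD i) (by simp) (by simp) (by
      intro i hi j hj hij
      obtain ⟨i', hi'⟩ := Option.isSome_iff_exists.mp ((hs i).mp hi)
      obtain ⟨j', hj'⟩ := Option.isSome_iff_exists.mp ((hs j).mp hj)
      simp only [hi', hj', Option.getD_some] at hij
      exact z.map.inj (Option.mem_def.mpr hi') (Option.mem_def.mpr (hij ▸ hj')))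
  refine ⟨sᶜ.toList, fun i => if h : z.tuple i ≠ 0 then WithZero.unzero h else 1,
    g.trans (Equiv.subtypeUnivEquiv fun i => Finset.mem_univ i), ?_, ?_⟩
  · intro hnil
    rw [Finset.toList_eq_nil, Finset.compl_eq_empty_iff] at hnil
    exact hz (z.map.exists_perm_of_dom (Set.eq_univ_of_forall fun i =>
      (hs i).mp (hnil ▸ Finset.mem_univ i)))
  · ext i : 2
    · rw [wreathOf_tuple]
      by_cases hi : z.tuple i = 0
      · rw [if_pos (by simp [hsupp, hi]), hi]
      · rw [if_neg (by simp [hsupp, hi]), dif_pos hi, WithZero.coe_unzero]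
    · rw [wreathOf_map]
      by_cases hi : i ∈ s
      · obtain ⟨i', hi'⟩ := Option.isSome_iff_exists.mp ((hs i).mp hi)
        have hgi := hg i hi
        rw [hi', Option.getD_some] at hgi
        rw [if_neg (by simp [hi]), hi', ← hgi]
        rfl
      · rw [if_pos (by simp [hi])]
        exact Option.not_isSome_iff_eq_none.mp fun hh => hi ((hs i).mpr hh)

theorem phiMS_surjective (hφ : Function.Surjective φ) : Function.Surjective (phiMS φ n) := by
  intro z
  obtain ⟨L, b, π, hL, hz⟩ := exists_wreathOf z.2
  obtain ⟨w, hw⟩ := isWordImage_wreathOf hφ hL b π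
  exact ⟨w, Subtype.ext (hw.trans hz.symm)⟩

end Surjective

end SingWreath

theorem mainTheorem6 {M : Type*} [Monoid M] {X : Type*} (R : FreeMonoid X → FreeMonoid X → Prop)
    (φ : FreeMonoid X →* M) (hφ : SingWreath.IsMonoidPresentation R φ) (n : ℕ) (hn : 2 ≤ n) :
    SingWreath.IsSemigroupPresentation (SingWreath.RelMS R n) (SingWreath.phiMS φ n) := by
  refine ⟨SingWreath.phiMS_surjective hφ.1, le_antisymm (fun u v h => ?_) (fun u v h => ?_)⟩
  · exact (Con.eq _).mp (SingWreath.presented_eq_of_phiMS_eq hφ h)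
  · exact SingWreath.phiMS_eq_of_presented_eq hφ ((Con.eq _).mpr h)
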